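/- Let $X$ and $U$ be real Hilbert spaces, $T>0$, $E=L^2(0,T;U)$, let $A$ generate a $C_0$-semigroup $(S_t)_{t\ge 0}$ on $X$ and let $B\in L(U,X)$. For $u\in E$, the (mild) solution of $\dot y=Ay+Bu$, $y(0)=y_0$, satisfies $y(T)=S_Ty_0+L_Tu$, where $L_T\in L(E,X)$, $L_Tu=\int_0^TS_{T-t}Bu(t)\,dt$. Let $y_0,y_f\in X$ and $\tilde y_T=y_f-S_Ty_0$. For a set $K$ in a Hilbert space, $\mathrm{cone}(K)=\{\lambda p:\ p\in K,\ \lambda>0\}$, and for a cone $P$, $P^\circ=\{y:\ \langle x,y\rangle\le 0\ \ \forall x\in P\}$. Given $P\subset U$, $y_f$ is approximately reachable from $y_0$ in time $T$ under the constraints $P$ if for every $\varepsilon>0$ there is $u\in E$ with $u(t)\in P$ for a.e. $t\in(0,T)$ which steers $y_0$ to $\overline B(y_f,\varepsilon)$ in time $T$, i.e. $\|y(T)-y_f\|\le\varepsilon$. Let $\mathcal U\subset U$ be bounded with $0\in\mathcal U$, and put $\mathcal U_r=\overline{\mathrm{conv}}(\mathcal U)$, $P=\mathrm{cone}(\mathcal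 U)$, $P_r=\mathrm{cone}(\mathcal U_r)$. Let $j_{\mathcal U_r}(v)=\inf\{\alpha>0:\ v\in\alpha\,\mathcal U_r\}\in[0,+\infty]$, let $F(u)=\frac12\int_0^Tj_{\mathcal U_r}(u(t))^2\,dt$ for $u\in E$, let $F^*$ be the convex conjugate of $F$ on $E$, $\partial F^*$ its subdifferential, and for $\varepsilon>0$ let $$J_\varepsilon(p_f)=F^*(L_T^*p_f)-\langle\tilde y_T,p_f\rangle+\varepsilon\|p_f\|,\qquad p_f\in X .$$ Let $\mathrm{sing}(\mathcal U_r)$ be the set of $v\in U$ such that $\langle v,\cdot\rangle$ attains its maximum over $\mathcal U_r$ at more than one point. **Theorem.** The state $y_f$ is approximately reachable from $y_0$ in time $T$ under the constraints $P_r$ if and only if $$\forall p_f\in X,\qquad F^*(L_T^*p_f)=0\ \Longrightarrow\ \langle\tilde y_T,p_f\rangle\le 0 .$$ Assume that this condition holds. Then for every $\varepsilon>0$ the functional $J_\varepsilon$ has a unique minimiser $p_f^\star$ over $X$, and at least one control $u\in\partial F^*(L_T^*p_f^\star)$ steers $y_0$ to $\overline B(y_f,\varepsilon)$ in time $T$.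 Furthermore, consider the conditions $$\text{(H)}\quad (L_T^*p_f^\star)(t)\notin\mathrm{sing}(\mathcal U_r)\cap (U\setminus P_r^\circ)\ \text{ for a.e. }t\in(0,T),\qquad\qquad \text{(E)}\quad \mathrm{ext}(\mathcal U_r)\subset\mathcal U ,$$ where $\mathrm{ext}(\mathcal U_r)$ is the set of extreme points of $\mathcal U_r$. * If (H) holds, then $\partial F^*(L_T^*p_f^\star)$ consists of exactly one control. Conversely, if $U$ is separable and $\partial F^*(L_T^*p_f^\star)$ consists of exactly one control, then (H) holds. * If (H) and (E) hold, then this unique control, which steers $y_0$ to $\overline B(y_f,\varepsilon)$ in time $T$, takes values in the original cone: $u(t)\in P$ for a.e. $t\in(0,T)$. -/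

import Mathlib

open MeasureTheory Set Filter Topology
open scoped NNReal ENNReal Pointwise

namespace ConicControl

section ConvexAnalysis

variable {H : Type*} [NormedAddCommGroup H] [InnerProductSpace ℝ H]

/-- The cone generated by `K`: all `a • p` with `p ∈ K` and `a > 0`. -/
def genCone (K : Set H) : Set H :=
  {x | ∃ a : ℝ, 0 < a ∧ ∃ p ∈ K, x = a • p}

/-- The polar cone of `P`. -/
def polarCone (P : Set H) : Set H :=
  {y | ∀ x ∈ P, inner ℝ x y ≤ 0}

/-- The closed convex hull of `K`. -/
def relaxedSet (K : Set H) : Set H :=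
  closure (convexHull ℝ K)

/-- The gauge function of `C`, with value `∞` off the cone generated by `C`. -/
noncomputable def gaugeFun (C : Set H) (x : H) : ℝ≥0∞ :=
  ⨅ (a : ℝ) (_ : 0 < a) (_ : x ∈ a • C), ENNReal.ofReal a

/-- The singular normal vectors of `C`: vectors `v` such that the maximum of `⟪v, ·⟫` over `C`
is reached at two distinct points at least. -/
def singularNormals (C : Set H) : Set H :=
  {v | ∃ x ∈ C, ∃ y ∈ C, x ≠ y ∧
    (∀ z ∈ C, inner ℝ v z ≤ inner ℝ v x) ∧ (∀ z ∈ C, inner ℝ v z ≤ inner ℝ v y)}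

/-- The convex conjugate. -/
noncomputable def conjugate (f : H → EReal) (x : H) : EReal :=
  ⨆ y : H, ((inner ℝ x y : ℝ) : EReal) - f y

/-- The subdifferential of `f` at `x`. -/
def subdifferential (f : H → EReal) (x : H) : Set H :=
  {p | ∀ y : H, f x + ((inner ℝ p (y - x) : ℝ) : EReal) ≤ f y}

end ConvexAnalysis

/-- A strongly continuous semigroup of bounded operators on `X`. -/
structure C0Semigroup (X : Type*) [NormedAddCommGroup X] [NormedSpace ℝ X] where
  /-- The operator at time `t`. -/
  op : ℝ≥0 → X →L[ℝ] X
  op_zero : op 0 = ContinuousLinearMap.id ℝ X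
  op_add : ∀ s t : ℝ≥0, op (s + t) = (op s).comp (op t)
  continuous_orbit : ∀ x : X, Continuous fun t : ℝ≥0 => op t x

/-- The unbounded operator `A` is the infinitesimal generator of `S`: the graph of `A` consists of
the pairs `(x, y)` such that `(S t x - x) / t` tends to `y` as `t` tends to `0` from the right. -/
def IsGenerator {X : Type*} [NormedAddCommGroup X] [NormedSpace ℝ X]
    (A : X →ₗ.[ℝ] X) (S : C0Semigroup X) : Prop :=
  ∀ x y : X, (x, y) ∈ A.graph ↔
    Tendsto (fun t : ℝ≥0 => (t : ℝ)⁻¹ • (S.op t x - x)) (𝓝[≠] 0) (𝓝 y)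

/-- The space `L²(0, T; U)` of controls. -/
abbrev ControlSpace (U : Type*) [NormedAddCommGroup U] (T : ℝ) : Type _ :=
  Lp U 2 (volume.restrict (Ioo (0 : ℝ) T))

theorem integrable_control {U : Type*} [NormedAddCommGroup U] (T : ℝ)
    (u : ControlSpace U T) :
    Integrable (u : ℝ → U) (volume.restrict (Ioo (0 : ℝ) T)) :=
  (Lp.memLp u).integrable (by norm_num)

section Control

variable {X U : Type*} [NormedAddCommGroup X] [InnerProductSpace ℝ X] [CompleteSpace X]
  [NormedAddCommGroup U] [InnerProductSpace ℝ U] [CompleteSpace U]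

/-- The (mild) solution at time `t` of `y' = A y + B u`, `y 0 = y₀`, where `A` generates `S`. -/
noncomputable def mildSolution (S : C0Semigroup X) (B : U →L[ℝ] X) (y₀ : X) (u : ℝ → U)
    (t : ℝ) : X :=
  S.op t.toNNReal y₀ + ∫ s in Ioo (0 : ℝ) t, S.op (t - s).toNNReal (B (u s))

theorem C0Semigroup.exists_bound (S : C0Semigroup X) (T : ℝ≥0) :
    ∃ M : ℝ, 0 ≤ M ∧ ∀ t ≤ T, ‖S.op t‖ ≤ M := by
  have h := banach_steinhaus (g := fun t : Icc (0 : ℝ≥0) T => S.op t) (fun x => by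
    obtain ⟨C, hC⟩ := (isCompact_Icc (a := (0 : ℝ≥0)) (b := T)).exists_bound_of_continuousOn
      (S.continuous_orbit x).continuousOn
    exact ⟨C, fun t => hC t t.2⟩)
  obtain ⟨M, hM⟩ := h
  exact ⟨M, (norm_nonneg _).trans (hM ⟨0, by simp⟩), fun t ht => hM ⟨t, by simp, ht⟩⟩

theorem C0Semigroup.continuous_uncurry (S : C0Semigroup X) :
    Continuous fun z : ℝ≥0 × X => S.op z.1 z.2 := by
  rw [continuous_iff_continuousAt]
  rintro ⟨t₀, x₀⟩
  obtain ⟨M, hM0, hM⟩ := S.exists_bound (t₀ + 1)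
  rw [ContinuousAt, tendsto_iff_norm_sub_tendsto_zero]
  have h1 : Tendsto (fun z : ℝ≥0 × X => M * ‖z.2 - x₀‖ + ‖S.op z.1 x₀ - S.op t₀ x₀‖)
      (𝓝 (t₀, x₀)) (𝓝 0) := by
    have hc : Continuous (fun z : ℝ≥0 × X => M * ‖z.2 - x₀‖ + ‖S.op z.1 x₀ - S.op t₀ x₀‖) := by
      have := (S.continuous_orbit x₀).comp (continuous_fst (X := ℝ≥0) (Y := X))
      simp only [Function.comp_def] at this
      fun_prop
    simpa using hc.tendsto (t₀, x₀)
  refine squeeze_zero' (Eventually.of_forall fun _ => norm_nonneg _) ?_ h1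
  have hev : ∀ᶠ z : ℝ≥0 × X in 𝓝 (t₀, x₀), z.1 < t₀ + 1 :=
    continuous_fst.continuousAt.eventually_lt continuousAt_const (by simp)
  filter_upwards [hev] with z hz
  have he : S.op z.1 z.2 - S.op t₀ x₀
      = S.op z.1 (z.2 - x₀) + (S.op z.1 x₀ - S.op t₀ x₀) := by
    rw [map_sub]; abel
  rw [he]
  refine (norm_add_le _ _).trans (add_le_add ?_ le_rfl)
  exact ((S.op z.1).le_opNorm _).trans (mul_le_mul_of_nonneg_right (hM _ hz.le) (norm_nonneg _))

theorem integrable_integrand (S : C0Semigroup X) (B : U →L[ℝ] X) (T : ℝ)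
    (u : ControlSpace U T) :
    Integrable (fun s : ℝ => S.op (T - s).toNNReal (B (u s)))
      (volume.restrict (Ioo (0 : ℝ) T)) := by
  obtain ⟨M, hM0, hM⟩ := S.exists_bound T.toNNReal
  have hu := integrable_control T u
  refine (hu.norm.const_mul (M * ‖B‖)).mono' ?_ ?_
  · have h1 : AEStronglyMeasurable (fun s : ℝ => ((T - s).toNNReal, B (u s)))
        (volume.restrict (Ioo (0 : ℝ) T)) :=
      (by fun_prop : Continuous fun s : ℝ => (T - s).toNNReal).aestronglyMeasurable.prodMk
        (B.continuous.comp_aestronglyMeasurable hu.aestronglyMeasurable)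
    exact S.continuous_uncurry.comp_aestronglyMeasurable h1
  · filter_upwards [ae_restrict_mem measurableSet_Ioo] with s hs
    calc ‖S.op (T - s).toNNReal (B (u s))‖
        ≤ M * (‖B‖ * ‖u s‖) :=
          ((S.op _).le_opNorm _).trans (mul_le_mul
            (hM _ (Real.toNNReal_le_toNNReal (by linarith [hs.1]))) (B.le_opNorm _)
            (norm_nonneg _) hM0)
      _ = M * ‖B‖ * ‖u s‖ := by ring

theorem exists_bound_inputMap (S : C0Semigroup X) (B : U →L[ℝ] X) (T : ℝ) :
    ∃ C : ℝ, ∀ u : ControlSpace U T,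
      ‖∫ s in Ioo (0 : ℝ) T, S.op (T - s).toNNReal (B (u s))‖ ≤ C * ‖u‖ := by
  obtain ⟨M, hM0, hM⟩ := S.exists_bound T.toNNReal
  set μ := volume.restrict (Ioo (0 : ℝ) T) with hμ
  set κ : ℝ := (μ univ ^ (1 / (1 : ℝ≥0∞).toReal - 1 / (2 : ℝ≥0∞).toReal)).toReal with hκ
  refine ⟨M * ‖B‖ * κ, fun u => ?_⟩
  have hu := integrable_control T u
  have h1 : ∫ s, ‖u s‖ ∂μ ≤ ‖u‖ * κ := by
    have h2 := eLpNorm_le_eLpNorm_mul_rpow_measure_univ (μ := μ) (p := 1) (q := 2)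
      (f := (u : ℝ → U)) (by norm_num) (Lp.aestronglyMeasurable u)
    have hfin : μ univ ^ (1 / (1 : ℝ≥0∞).toReal - 1 / (2 : ℝ≥0∞).toReal) ≠ ∞ :=
      ENNReal.rpow_ne_top_of_nonneg (by norm_num) (measure_ne_top μ univ)
    have h3 := ENNReal.toReal_mono (ENNReal.mul_ne_top (Lp.eLpNorm_ne_top u) hfin) h2
    rw [ENNReal.toReal_mul] at h3
    rw [integral_norm_eq_lintegral_enorm hu.aestronglyMeasurable, ← eLpNorm_one_eq_lintegral_enorm,
      Lp.norm_def]
    exact h3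
  calc ‖∫ s, S.op (T - s).toNNReal (B (u s)) ∂μ‖
      ≤ ∫ s, M * ‖B‖ * ‖u s‖ ∂μ := by
        refine norm_integral_le_of_norm_le (hu.norm.const_mul _) ?_
        filter_upwards [ae_restrict_mem measurableSet_Ioo] with s hs
        calc ‖S.op (T - s).toNNReal (B (u s))‖
            ≤ M * (‖B‖ * ‖u s‖) :=
              ((S.op _).le_opNorm _).trans (mul_le_mul
                (hM _ (Real.toNNReal_le_toNNReal (by linarith [hs.1]))) (B.le_opNorm _)
                (norm_nonneg _) hM0)
          _ = M * ‖B‖ * ‖u s‖ := by ring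
    _ = M * ‖B‖ * ∫ s, ‖u s‖ ∂μ := integral_const_mul _ _
    _ ≤ M * ‖B‖ * (‖u‖ * κ) := mul_le_mul_of_nonneg_left h1 (by positivity)
    _ = M * ‖B‖ * κ * ‖u‖ := by ring

/-- The input map `u ↦ ∫₀ᵀ S (T - s) B u(s) ds`, a bounded operator from `L²(0, T; U)` to `X`. -/
noncomputable def inputMap (S : C0Semigroup X) (B : U →L[ℝ] X) (T : ℝ) :
    ControlSpace U T →L[ℝ] X :=
  LinearMap.mkContinuousOfExistsBound
    { toFun := fun u => ∫ s in Ioo (0 : ℝ) T, S.op (T - s).toNNReal (B (u s))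
      map_add' := fun u v => by
        rw [← integral_add (integrable_integrand S B T u) (integrable_integrand S B T v)]
        refine integral_congr_ae ?_
        filter_upwards [Lp.coeFn_add u v] with s hs
        rw [hs, Pi.add_apply, map_add, map_add]
      map_smul' := fun c u => by
        rw [RingHom.id_apply, ← integral_smul]
        refine integral_congr_ae ?_
        filter_upwards [Lp.coeFn_smul c u] with s hs
        rw [hs, Pi.smul_apply, map_smul, map_smul] }
    (exists_bound_inputMap S B T)

theorem inputMap_apply (S : C0Semigroup X) (B : U →L[ℝ] X) (T : ℝ) (u : ControlSpace U T) :
    inputMap S B T u = ∫ s in Ioo (0 : ℝ) T, S.op (T - s).toNNReal (B (u s)) :=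
  rfl

/-- The control `u` steers `y₀` to the closed ball of centre `yf` and radius `ε` in time `T`. -/
def Steers (S : C0Semigroup X) (B : U →L[ℝ] X) (T : ℝ) (y₀ yf : X) (ε : ℝ)
    (u : ControlSpace U T) : Prop :=
  mildSolution S B y₀ u T ∈ Metric.closedBall yf ε

/-- The control `u` takes its values in `P` at almost every time. -/
def TakesValuesIn {T : ℝ} (u : ControlSpace U T) (P : Set U) : Prop :=
  ∀ᵐ t ∂(volume.restrict (Ioo (0 : ℝ) T)), u t ∈ P

/-- `yf` is approximately reachable from `y₀` in time `T` under the constraints `P`. -/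
def ApproxReachable (S : C0Semigroup X) (B : U →L[ℝ] X) (T : ℝ) (P : Set U) (y₀ yf : X) : Prop :=
  ∀ ε : ℝ, 0 < ε → ∃ u : ControlSpace U T, TakesValuesIn u P ∧ Steers S B T y₀ yf ε u

/-- The primal cost `F(u) = ½ ∫₀ᵀ j_C(u(t))² dt`, where `j_C` is the gauge function of `C`. -/
noncomputable def primalCost (C : Set U) (T : ℝ) (u : ControlSpace U T) : EReal :=
  (((1 / 2 : ℝ≥0∞) * ∫⁻ t in Ioo (0 : ℝ) T, gaugeFun C (u t) ^ 2 : ℝ≥0∞) : EReal)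

/-- The convex conjugate `F*` of the primal cost. -/
noncomputable def dualCost (C : Set U) (T : ℝ) : ControlSpace U T → EReal :=
  conjugate (primalCost C T)

/-- The dual functional `J_ε(p) = F*(L_T* p) - ⟪yf - S_T y₀, p⟫ + ε ‖p‖`. -/
noncomputable def dualFunctional (S : C0Semigroup X) (B : U →L[ℝ] X) (T : ℝ) (C : Set U)
    (y₀ yf : X) (ε : ℝ) (p : X) : EReal :=
  dualCost C T ((inputMap S B T).adjoint p)
    - ((inner ℝ (yf - S.op T.toNNReal y₀) p : ℝ) : EReal) + ((ε * ‖p‖ : ℝ) : EReal)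

/-- `q(t)` avoids, for almost every time `t`, the singular normal vectors of `C` that do not belong
to the polar cone of the cone generated by `C`. -/
def AvoidsSingular (C : Set U) {T : ℝ} (q : ControlSpace U T) : Prop :=
  ∀ᵐ t ∂(volume.restrict (Ioo (0 : ℝ) T)),
    q t ∉ singularNormals C ∩ (polarCone (genCone C))ᶜ

end Control

end ConicControl

open ConicControl

/-! The argument is Fenchel duality between the steering problem, minimise `F u` subject to `‖L u -
y‖ ≤ ε`, and the dual functional `J p = F* (L* p) - ⟪y, p⟫ + ε ‖p‖`. The structure `IsQuadCost`
isolates what the abstract part needs from the cost: it vanishes at 0, is positively 2-homogeneous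
and coercive, and its sublevel sets are closed and convex.

The central lemma is `exists_le_of_dual_bound`: if `J ≥ -m` everywhere, then some `u` with `F u ≤ m`
reaches the closed `ε`-ball. It follows from separating an open ball from the image of a sublevel
set, rescaling the separating functional, and intersecting nested closed convex sets to remove the
slack. Applied with `m = -min J`, it gives a control that attains equality in the Fenchel
inequality, hence a subgradient that steers. Applied to the identity map with `ε = 0`, it plays the
role of Fenchel–Moreau. Approximate reachability makes `J` coercive, so a minimiser exists. Two
minimisers must lie on a common ray, by strict convexity of the norm up to rays, and along that ray
`J` is an explicit polynomial of degree at most 2.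

For the gauge cost everything becomes pointwise: `mem_subdifferential_gaugeCost_iff` says that `u`
is a subgradient at `q` exactly when, almost everywhere, `u t = ⟪q t, c⟫ c` for some maximiser `c`
of `⟪q t, ·⟫` over `C`. Where the maximum is 0, `u t` vanishes whichever `c` is chosen; elsewhere
uniqueness of `u t` is uniqueness of the maximiser, and a unique maximiser is an extreme point. The
converse needs measurable selections of maximisers, built in `exists_maximizer_selection` as limits
of projections. -/

namespace ConicControl

/-! ### Nested convex sets in Hilbert space, in place of weak compactness. -/

section Hilbert

/-- A sequence whose squared distances are controlled by the increments of a bounded real sequence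
converges. -/
theorem exists_tendsto_of_sq_dist_le {H : Type*} [NormedAddCommGroup H] [CompleteSpace H]
    {x : ℕ → H} {a : ℕ → ℝ} {M : ℝ} (ha : ∀ n, a n ≤ M) (h : ∀ n m, n ≤ m → ‖x m - x n‖ ^ 2 ≤ a m - a n) :
    ∃ y, Tendsto x atTop (𝓝 y) := by
  have hmono : Monotone a := fun n m hnm => by linarith [h n m hnm, sq_nonneg ‖x m - x n‖]
  have hc : CauchySeq a :=
    (tendsto_atTop_ciSup hmono ⟨M, by rintro _ ⟨n, rfl⟩; exact ha n⟩).cauchySeq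
  refine cauchySeq_tendsto_of_complete (Metric.cauchySeq_iff'.2 fun ε hε => ?_)
  obtain ⟨N, hN⟩ := Metric.cauchySeq_iff'.1 hc (ε ^ 2) (by positivity)
  refine ⟨N, fun n hn => ?_⟩
  have h1 := hN n hn
  rw [Real.dist_eq] at h1
  rw [dist_eq_norm]
  exact lt_of_pow_lt_pow_left₀ 2 hε.le
    (((h N n hn).trans (le_abs_self _)).trans_lt h1)

variable {H : Type*} [NormedAddCommGroup H] [InnerProductSpace ℝ H]

/-- Nested nonempty bounded closed convex sets of a Hilbert space have a common point. -/
theorem nonempty_iInter_of_antitone_convex [CompleteSpace H] {K : ℕ → Set H} (hanti : Antitone K)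
    (hne : ∀ n, (K n).Nonempty) (hcl : ∀ n, IsClosed (K n)) (hconv : ∀ n, Convex ℝ (K n))
    {M : ℝ} (hM : ∀ x ∈ K 0, ‖x‖ ≤ M) : ∃ x, ∀ n, x ∈ K n := by
  -- The candidate point is the limit of the minimal-norm elements of the sets `K n`.
  choose x hx hmin using fun n =>
    exists_norm_eq_iInf_of_complete_convex (hne n) (hcl n).isComplete (hconv n) 0
  have hvar := fun n => (norm_eq_iInf_iff_real_inner_le_zero (hconv n) (hx n)).1 (hmin n)
  obtain ⟨y, hy⟩ := exists_tendsto_of_sq_dist_le (x := x) (a := fun n => ‖x n‖ ^ 2) (M := M ^ 2)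
    (fun n => pow_le_pow_left₀ (norm_nonneg _) (hM _ (hanti (Nat.zero_le n) (hx n))) 2)
    -- The variational inequality at `x n`, tested with `x m`, reads `‖x n‖² ≤ ⟪x n, x m⟫`.
    (fun n m hnm => by
      have h1 := hvar n (x m) (hanti hnm (hx m))
      simp only [zero_sub, inner_neg_left, inner_sub_right, real_inner_self_eq_norm_sq] at h1
      rw [@norm_sub_sq_real, real_inner_comm]
      linarith)
  exact ⟨y, fun n => (hcl n).mem_of_tendsto hy
    ((eventually_ge_atTop n).mono fun m hm => hanti hm (hx m))⟩

end Hilbert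

/-! ### Abstract duality for 2-homogeneous coercive costs. -/

section QuadCost

variable {E X : Type*} [NormedAddCommGroup E] [InnerProductSpace ℝ E]
  [NormedAddCommGroup X] [InnerProductSpace ℝ X]

/-- A positively `2`-homogeneous, lower semicontinuous, quasiconvex and coercive cost. -/
structure IsQuadCost (F : E → ℝ≥0∞) : Prop where
  zero : F 0 = 0
  smul : ∀ a : ℝ, 0 < a → ∀ u, F (a • u) = ENNReal.ofReal (a ^ 2) * F u
  isClosed : ∀ m, IsClosed {u | F u ≤ m}
  convex : ∀ m, Convex ℝ {u | F u ≤ m}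
  coercive : ∃ c : ℝ, 0 < c ∧ ∀ u, ENNReal.ofReal (c * ‖u‖ ^ 2) ≤ F u

/-- The convex conjugate of a coercive cost, as a real-valued function. -/
noncomputable def realConj (F : E → ℝ≥0∞) (q : E) : ℝ :=
  ⨆ u : {u // F u ≠ ∞}, (inner ℝ q (u : E) - (F u).toReal)

variable {F : E → ℝ≥0∞}

namespace IsQuadCost

variable (hF : IsQuadCost F)
include hF

theorem exists_le_toReal : ∃ c : ℝ, 0 < c ∧ ∀ u, F u ≠ ∞ → c * ‖u‖ ^ 2 ≤ (F u).toReal := by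
  obtain ⟨c, hc, h⟩ := hF.coercive
  exact ⟨c, hc, fun u hu => (ENNReal.ofReal_le_iff_le_toReal hu).1 (h u)⟩

theorem smul_ne_top {u : E} (hu : F u ≠ ∞) {a : ℝ} (ha : 0 < a) : F (a • u) ≠ ∞ := by
  rw [hF.smul a ha]; exact ENNReal.mul_ne_top ENNReal.ofReal_ne_top hu

theorem toReal_smul (u : E) {a : ℝ} (ha : 0 < a) :
    (F (a • u)).toReal = a ^ 2 * (F u).toReal := by
  rw [hF.smul a ha, ENNReal.toReal_mul, ENNReal.toReal_ofReal (by positivity)]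

theorem zero_ne_top : F 0 ≠ ∞ := by simp [hF.zero]

theorem bddAbove (q : E) :
    BddAbove (range fun u : {u // F u ≠ ∞} => inner ℝ q (u : E) - (F u).toReal) := by
  obtain ⟨c, hc, h⟩ := hF.exists_le_toReal
  -- This is the maximum of `‖q‖ t - c t²` over real `t`.
  refine ⟨‖q‖ ^ 2 / (4 * c), ?_⟩
  rintro _ ⟨⟨u, hu⟩, rfl⟩
  have h1 := h u hu
  have h2 := real_inner_le_norm q u
  have h3 : ‖q‖ * ‖u‖ - c * ‖u‖ ^ 2 ≤ ‖q‖ ^ 2 / (4 * c) := by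
    rw [le_div_iff₀ (by positivity)]
    nlinarith [sq_nonneg (‖q‖ - 2 * c * ‖u‖)]
  simp only
  linarith

theorem le_realConj (q : E) {u : E} (hu : F u ≠ ∞) :
    inner ℝ q u - (F u).toReal ≤ realConj F q :=
  le_ciSup (hF.bddAbove q) ⟨u, hu⟩

theorem realConj_le_iff {q : E} {r : ℝ} :
    realConj F q ≤ r ↔ ∀ u, F u ≠ ∞ → inner ℝ q u - (F u).toReal ≤ r := by
  have : Nonempty {u // F u ≠ ∞} := ⟨0, hF.zero_ne_top⟩
  exact ⟨fun h u hu => (hF.le_realConj q hu).trans h, fun h => ciSup_le fun u => h u u.2⟩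

/-- Points of infinite cost contribute `-∞` and drop out of the supremum; coercivity keeps what
remains finite. -/
theorem conjugate_eq (q : E) :
    conjugate (fun u => (F u : EReal)) q = (realConj F q : EReal) := by
  refine le_antisymm (iSup_le fun u => ?_) ?_
  · by_cases hu : F u = ∞
    · simp [hu]
    · simp only
      rw [← EReal.coe_ennreal_toReal hu, ← EReal.coe_sub]
      exact_mod_cast hF.le_realConj q hu
  · refine EReal.le_of_forall_lt_iff_le.1 fun z hz => ?_
    by_contra hcon
    have : realConj F q ≤ z := by
      refine hF.realConj_le_iff.2 fun u hu => ?_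
      have h1 : ((inner ℝ q u : ℝ) : EReal) - F u ≤ z :=
        (le_iSup (fun y : E => ((inner ℝ q y : ℝ) : EReal) - F y) u).trans
          hz.le
      rw [← EReal.coe_ennreal_toReal hu, ← EReal.coe_sub] at h1
      exact_mod_cast h1
    exact hcon (by exact_mod_cast this)

theorem realConj_nonneg (q : E) : 0 ≤ realConj F q := by
  simpa [hF.zero] using hF.le_realConj q hF.zero_ne_top

theorem realConj_zero : realConj F 0 = 0 :=
  le_antisymm (hF.realConj_le_iff.2 fun u _ => by simp) (hF.realConj_nonneg 0)

theorem realConj_smul_le (q : E) {a : ℝ} (ha : 0 < a) :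
    realConj F (a • q) ≤ a ^ 2 * realConj F q := by
  refine hF.realConj_le_iff.2 fun u hu => ?_
  have ha' : 0 < a⁻¹ := inv_pos.2 ha
  have h1 := hF.le_realConj q (hF.smul_ne_top hu ha')
  rw [hF.toReal_smul u ha', inner_smul_right] at h1
  rw [real_inner_smul_left]
  calc a * inner ℝ q u - (F u).toReal
      = a ^ 2 * (a⁻¹ * inner ℝ q u - a⁻¹ ^ 2 * (F u).toReal) := by field_simp
    _ ≤ _ := by gcongr

theorem realConj_smul (q : E) {a : ℝ} (ha : 0 ≤ a) :
    realConj F (a • q) = a ^ 2 * realConj F q := by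
  rcases ha.eq_or_lt with rfl | ha
  · simp [hF.realConj_zero]
  refine le_antisymm (hF.realConj_smul_le q ha) ?_
  have h := hF.realConj_smul_le (a • q) (inv_pos.2 ha)
  rw [smul_smul, inv_mul_cancel₀ ha.ne', one_smul] at h
  calc a ^ 2 * realConj F q ≤ a ^ 2 * (a⁻¹ ^ 2 * realConj F (a • q)) := by gcongr
    _ = _ := by field_simp

theorem realConj_midpoint_le (p q : E) :
    realConj F ((1 / 2 : ℝ) • (p + q)) ≤ (realConj F p + realConj F q) / 2 := by
  refine hF.realConj_le_iff.2 fun u hu => ?_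
  have h1 := hF.le_realConj p hu
  have h2 := hF.le_realConj q hu
  rw [real_inner_smul_left, inner_add_left]
  linarith

/-- Along a ray, the expression in the supremum is `a ⟪q, u⟫ - a² F u`, which is positive for small
`a > 0` as soon as `⟪q, u⟫ > 0`. -/
theorem realConj_eq_zero_iff {q : E} :
    realConj F q = 0 ↔ ∀ u, F u ≠ ∞ → inner ℝ q u ≤ 0 := by
  constructor
  · intro h u hu
    by_contra! hpos
    have hb : 0 ≤ (F u).toReal := ENNReal.toReal_nonneg
    -- This is the maximiser of `a ⟪q, u⟫ - a² (F u + 1)`; the added 1 covers `F u = 0`.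
    have ha : 0 < inner ℝ q u / (2 * ((F u).toReal + 1)) := by positivity
    have h1 := hF.le_realConj q (hF.smul_ne_top hu ha)
    rw [h, hF.toReal_smul u ha, inner_smul_right] at h1
    set a := inner ℝ q u / (2 * ((F u).toReal + 1)) with hadef
    have h2 : inner ℝ q u = a * (2 * ((F u).toReal + 1)) := by
      rw [hadef]; field_simp
    rw [h2] at h1
    nlinarith [mul_pos ha ha, mul_nonneg (mul_pos ha ha).le hb]
  · intro h
    exact le_antisymm (hF.realConj_le_iff.2 fun u hu => by
      linarith [h u hu, ENNReal.toReal_nonneg (a := F u)]) (hF.realConj_nonneg q)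

/-- A linear form bounded by `b` on a sublevel set has a small conjugate. -/
theorem realConj_le_of_forall_sublevel {q : E} {M b : ℝ} (hM : 0 < M)
    (h : ∀ u, F u ≤ ENNReal.ofReal M → inner ℝ q u ≤ b) :
    4 * M * realConj F q ≤ b ^ 2 := by
  suffices realConj F q ≤ b ^ 2 / (4 * M) by
    rw [le_div_iff₀ (by positivity)] at this; linarith
  refine hF.realConj_le_iff.2 fun u hu => ?_
  have hnn : 0 ≤ (F u).toReal := ENNReal.toReal_nonneg
  rcases hnn.eq_or_lt with h0 | h0
  · obtain ⟨c, hc, hcu⟩ := hF.exists_le_toReal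
    have h1 := hcu u hu
    rw [← h0] at h1
    have h2 : ‖u‖ ^ 2 ≤ 0 := by
      by_contra! h3
      nlinarith [mul_pos hc h3]
    have h3 : u = 0 := by simpa using le_antisymm h2 (by positivity)
    subst h3
    simp only [inner_zero_right]
    have : 0 ≤ b ^ 2 / (4 * M) := by positivity
    linarith
  · set s := √((F u).toReal) with hs
    have hs0 : 0 < s := Real.sqrt_pos.2 h0
    have hsq : s ^ 2 = (F u).toReal := Real.sq_sqrt hnn
    set r := √M with hr
    have hr0 : 0 < r := Real.sqrt_pos.2 hM
    have hrq : r ^ 2 = M := Real.sq_sqrt hM.le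
    -- The rescaled point has cost exactly `M`, so `⟪q, u⟫ ≤ b s / r`; then `b s / r - s²` is at
    -- most `b² / (4 r²)`.
    have h1 : inner ℝ q ((r / s) • u) ≤ b := by
      refine h _ ?_
      rw [ENNReal.le_ofReal_iff_toReal_le (hF.smul_ne_top hu (by positivity)) hM.le,
        hF.toReal_smul u (by positivity), ← hsq, div_pow, hrq]
      field_simp
      exact le_rfl
    rw [inner_smul_right, div_mul_eq_mul_div, div_le_iff₀ hs0] at h1
    rw [le_div_iff₀ (by positivity), ← hsq, ← hrq]
    nlinarith [sq_nonneg (b - 2 * r * s), mul_le_mul_of_nonneg_left h1 hr0.le]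

theorem convex_domain : Convex ℝ {u | F u ≠ ∞} := by
  intro u hu v hv a b ha hb hab
  have hu' : u ∈ {w | F w ≤ max (F u) (F v)} := le_max_left (F u) (F v)
  have hv' : v ∈ {w | F w ≤ max (F u) (F v)} := le_max_right (F u) (F v)
  have hmax : max (F u) (F v) ≠ ∞ := (max_lt (lt_top_iff_ne_top.2 hu) (lt_top_iff_ne_top.2 hv)).ne
  exact ne_top_of_le_ne_top hmax (hF.convex _ hu' hv' ha hb hab)

variable [CompleteSpace E] [CompleteSpace X]

/-- Minimax: a lower bound on the dual functional yields an admissible point of low cost. -/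
theorem exists_le_of_dual_bound (L : E →L[ℝ] X) (y : X) {ε m : ℝ} (hε : 0 ≤ ε) (hm : 0 ≤ m)
    (h : ∀ p : X, -m ≤ realConj F (L.adjoint p) - inner ℝ y p + ε * ‖p‖) :
    ∃ u, F u ≤ ENNReal.ofReal m ∧ ‖L u - y‖ ≤ ε := by
  -- The slack `δ` makes the ball open and nonempty even for `ε = 0`, so that Hahn–Banach applies.
  have key : ∀ δ : ℝ, 0 < δ → ∃ u, F u ≤ ENNReal.ofReal (m + δ) ∧ ‖L u - y‖ ≤ ε + δ := by
    intro δ hδ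
    by_contra! hcon
    have hdisj : Disjoint (Metric.ball y (ε + δ)) (L '' {u | F u ≤ ENNReal.ofReal (m + δ)}) := by
      rw [Set.disjoint_left]
      rintro _ hx ⟨u, hu, rfl⟩
      rw [Metric.mem_ball, dist_eq_norm] at hx
      exact absurd hx (not_lt.2 (hcon u hu).le)
    obtain ⟨f, s, hf1, hf2⟩ := geometric_hahn_banach_open (convex_ball y (ε + δ))
      Metric.isOpen_ball ((hF.convex _).linear_image L.toLinearMap) hdisj
    have hs : s ≤ 0 := by
      simpa using hf2 (L 0) ⟨0, by simp [hF.zero], rfl⟩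
    set p : X := -(InnerProductSpace.toDual ℝ X).symm f with hp
    have hfp : ∀ x, f x = -inner ℝ p x := fun x => by simp [hp]
    have hyp : (ε + δ) * ‖p‖ ≤ inner ℝ y p + s := by
      have hR : 0 < ε + δ := by positivity
      have hball : ∀ r : ℝ, 0 ≤ r → r < ε + δ → r * ‖p‖ ≤ inner ℝ y p + s := by
        intro r hr0 hr
        by_cases hp0 : p = 0
        · have := hf1 y (Metric.mem_ball_self hR)
          rw [hfp, hp0] at this
          simp only [inner_zero_left, neg_zero] at this
          linarith
        have hpn : 0 < ‖p‖ := norm_pos_iff.2 hp0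
        -- Among the points at distance `r` from `y`, this one maximises `f = -⟪p, ·⟫`.
        have h1 := hf1 (y - (r / ‖p‖) • p) (by
          rw [Metric.mem_ball, dist_eq_norm, sub_sub_cancel_left, norm_neg, norm_smul,
            Real.norm_eq_abs, abs_of_nonneg (by positivity), div_mul_cancel₀ _ hpn.ne']
          exact hr)
        rw [hfp, inner_sub_right, inner_smul_right, real_inner_self_eq_norm_sq,
          real_inner_comm] at h1
        have h2 : r / ‖p‖ * ‖p‖ ^ 2 = r * ‖p‖ := by field_simp
        linarith
      refine le_of_forall_lt_imp_le_of_dense fun c hc => ?_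
      by_cases hp0 : ‖p‖ = 0
      · rw [hp0, mul_zero] at hc
        have := hball 0 le_rfl hR
        rw [zero_mul] at this
        linarith
      have hpn : 0 < ‖p‖ := lt_of_le_of_ne (norm_nonneg _) (Ne.symm hp0)
      have h4 : c / ‖p‖ < ε + δ := by rwa [div_lt_iff₀ hpn]
      refine le_trans ?_ (hball (max 0 (c / ‖p‖)) (le_max_left _ _) (max_lt hR h4))
      calc c = c / ‖p‖ * ‖p‖ := by field_simp
        _ ≤ _ := by gcongr; exact le_max_right _ _
    have hp0 : 0 < ‖p‖ := by
      rw [norm_pos_iff]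
      intro hp0
      have h1 := hf1 y (Metric.mem_ball_self (by positivity))
      have h2 := hf2 (L 0) ⟨0, by simp [hF.zero], rfl⟩
      rw [hfp, hp0] at h1 h2
      simp only [inner_zero_left] at h1 h2
      linarith
    have hsub := hF.realConj_le_of_forall_sublevel (q := L.adjoint p) (M := m + δ) (b := -s)
      (by positivity) (fun u hu => by
        have := hf2 (L u) ⟨u, hu, rfl⟩
        rw [hfp] at this
        rw [ContinuousLinearMap.adjoint_inner_left]
        linarith)
    -- `β` bounds `⟪y, p⟫ - ε ‖p‖` from below, while `hsub` and `s² ≤ β²` give `4 (m + δ) F* (L* p)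
    -- ≤ β²`. At the multiple `2 (m + δ) / β` of `p` the dual functional is therefore at most `(m +
    -- δ) - 2 (m + δ) < -m`.
    set β := -s + δ * ‖p‖ with hβ
    have hβ0 : 0 < β := by have := mul_pos hδ hp0; linarith
    have hM0 : 0 < m + δ := by positivity
    have hlam : 0 ≤ 2 * (m + δ) / β := by positivity
    have h1 := h ((2 * (m + δ) / β) • p)
    rw [map_smul, hF.realConj_smul _ hlam, inner_smul_right, norm_smul, Real.norm_eq_abs,
      abs_of_nonneg hlam] at h1
    have hG : (2 * (m + δ) / β) ^ 2 * realConj F (L.adjoint p) ≤ m + δ := by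
      rw [div_pow, div_mul_eq_mul_div, div_le_iff₀ (by positivity)]
      have h2 : s ^ 2 ≤ β ^ 2 := by
        have := mul_pos hδ hp0
        nlinarith
      nlinarith
    have h3 : 2 * (m + δ) / β * (inner ℝ y p - ε * ‖p‖) ≥ 2 * (m + δ) / β * β :=
      mul_le_mul_of_nonneg_left (by linarith) hlam
    rw [div_mul_cancel₀ _ hβ0.ne'] at h3
    linarith
  obtain ⟨c, hc, hcoer⟩ := hF.coercive
  set δ : ℕ → ℝ := fun n => 1 / ((n : ℝ) + 1) with hδ
  have hδpos : ∀ n, 0 < δ n := fun n => Nat.one_div_pos_of_nat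
  have hδanti : Antitone δ := fun n k hnk => Nat.one_div_le_one_div hnk
  have hδlim : Tendsto δ atTop (𝓝 0) := tendsto_one_div_add_atTop_nhds_zero_nat
  -- Coercivity bounds these sets, so the approximate solutions for `δ n → 0` have a common point.
  obtain ⟨u, hu⟩ := nonempty_iInter_of_antitone_convex
    (K := fun n => {u | F u ≤ ENNReal.ofReal (m + δ n)} ∩ L ⁻¹' Metric.closedBall y (ε + δ n))
    (fun n k hnk u hu => ⟨hu.1.trans (ENNReal.ofReal_le_ofReal (by linarith [hδanti hnk])),
      Metric.closedBall_subset_closedBall (by linarith [hδanti hnk]) hu.2⟩)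
    (fun n => by
      obtain ⟨u, h1, h2⟩ := key (δ n) (hδpos n)
      exact ⟨u, h1, by simpa [dist_eq_norm] using h2⟩)
    (fun n => (hF.isClosed _).inter (Metric.isClosed_closedBall.preimage L.continuous))
    (fun n => (hF.convex _).inter ((convex_closedBall _ _).linear_preimage L.toLinearMap))
    (M := (m + δ 0) / c + 1)
    (fun u hu => by
      have h1 : c * ‖u‖ ^ 2 ≤ m + δ 0 :=
        (ENNReal.ofReal_le_ofReal_iff (add_nonneg hm (hδpos 0).le)).1 ((hcoer u).trans hu.1)
      have h2 : ‖u‖ ^ 2 ≤ (m + δ 0) / c := by rw [le_div_iff₀ hc]; linarith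
      nlinarith [sq_nonneg (‖u‖ - 1), norm_nonneg u])
  refine ⟨u, ?_, ?_⟩
  · have : Tendsto (fun n => ENNReal.ofReal (m + δ n)) atTop (𝓝 (ENNReal.ofReal m)) :=
      ENNReal.tendsto_ofReal (by simpa using hδlim.const_add m)
    exact ge_of_tendsto' this fun n => (hu n).1
  · have : Tendsto (fun n => ε + δ n) atTop (𝓝 ε) := by simpa using hδlim.const_add ε
    exact ge_of_tendsto' this fun n => by simpa [dist_eq_norm] using (hu n).2

/-- The equality case of the Fenchel inequality characterises the subdifferential. -/
theorem mem_subdifferential_iff {q u : E} :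
    u ∈ subdifferential (conjugate fun u => (F u : EReal)) q ↔
      F u ≠ ∞ ∧ (F u).toReal + realConj F q ≤ inner ℝ q u := by
  have hreal : u ∈ subdifferential (conjugate fun u => (F u : EReal)) q ↔
      ∀ p, realConj F q + inner ℝ u (p - q) ≤ realConj F p := by
    refine forall_congr' fun p => ?_
    rw [hF.conjugate_eq, hF.conjugate_eq, ← EReal.coe_add, EReal.coe_le_coe_iff]
  rw [hreal]
  constructor
  · intro h
    have h0 := h 0
    rw [hF.realConj_zero, zero_sub, inner_neg_right, real_inner_comm] at h0
    -- The subgradient inequality says that `F* - ⟪u, ·⟫` is bounded below by `-m`; with `ε = 0` the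
    -- point produced can only be `u`, whence `F u ≤ m`.
    obtain ⟨v, hv, hvu⟩ := hF.exists_le_of_dual_bound (ContinuousLinearMap.id ℝ E) u
      (m := inner ℝ q u - realConj F q) le_rfl (by linarith) (fun p => by
        have := h p
        rw [inner_sub_right, real_inner_comm q u] at this
        simp only [ContinuousLinearMap.adjoint_id, ContinuousLinearMap.id_apply]
        linarith)
    have hvu' : v = u := by
      simpa [sub_eq_zero] using le_antisymm hvu (norm_nonneg _)
    subst hvu'
    have hne : F v ≠ ∞ := ne_top_of_le_ne_top ENNReal.ofReal_ne_top hv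
    exact ⟨hne, by
      have := (ENNReal.le_ofReal_iff_toReal_le hne (by linarith)).1 hv
      linarith⟩
  · rintro ⟨hu, h⟩ p
    have := hF.le_realConj p hu
    rw [inner_sub_right, real_inner_comm, real_inner_comm q u]
    linarith

/-- The closed cone of reachable states is characterised by its polar. -/
theorem mem_closure_image_domain_iff (L : E →L[ℝ] X) (y : X) :
    y ∈ closure (L '' {u | F u ≠ ∞}) ↔
      ∀ p : X, realConj F (L.adjoint p) = 0 → inner ℝ y p ≤ 0 := by
  constructor
  · intro hy p hp
    have hcl : IsClosed {z : X | inner ℝ z p ≤ 0} :=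
      isClosed_le (by fun_prop) continuous_const
    refine closure_minimal ?_ hcl hy
    rintro _ ⟨u, hu, rfl⟩
    have := hF.realConj_eq_zero_iff.1 hp u hu
    rwa [ContinuousLinearMap.adjoint_inner_left, real_inner_comm] at this
  · intro h
    by_contra hy
    obtain ⟨f, s, hf1, hf2⟩ := geometric_hahn_banach_closed_point
      ((hF.convex_domain.linear_image L.toLinearMap).closure) isClosed_closure hy
    have hs : 0 < s := by
      simpa using hf1 (L 0) (subset_closure ⟨0, hF.zero_ne_top, rfl⟩)
    set p : X := (InnerProductSpace.toDual ℝ X).symm f with hp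
    have hfp : ∀ x, f x = inner ℝ p x := fun x => by simp [hp]
    have h0 : realConj F (L.adjoint p) = 0 := by
      refine hF.realConj_eq_zero_iff.2 fun u hu => ?_
      rw [ContinuousLinearMap.adjoint_inner_left, ← hfp]
      by_contra! hpos
      -- The domain is a cone, so `u` can be scaled until `f` takes the value `s`, contradicting
      -- strict separation.
      have h1 := hf1 (L ((s / f (L u)) • u)) (subset_closure
        ⟨_, hF.smul_ne_top hu (by positivity), rfl⟩)
      rw [map_smul, map_smul, smul_eq_mul, div_mul_cancel₀ _ hpos.ne'] at h1
      exact lt_irrefl _ h1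
    have := h p h0
    rw [real_inner_comm, ← hfp] at this
    linarith

/-- The minimiser of the dual functional exists as soon as the target is approximately
reachable. -/
theorem exists_min_dual (L : E →L[ℝ] X) (y : X) {ε : ℝ} (hε : 0 < ε)
    (hy : y ∈ closure (L '' {u | F u ≠ ∞})) :
    ∃ p : X, ∀ p' : X, realConj F (L.adjoint p) - inner ℝ y p + ε * ‖p‖ ≤
      realConj F (L.adjoint p') - inner ℝ y p' + ε * ‖p'‖ := by
  set J : X → ℝ := fun p => realConj F (L.adjoint p) - inner ℝ y p + ε * ‖p‖ with hJ
  -- Testing the conjugate at `w` bounds `F* (L* p) - ⟪y, p⟫` below by `-F w - (ε / 2) ‖p‖`; the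
  -- other half of `ε ‖p‖` gives coercivity.
  obtain ⟨_, ⟨w, hw, rfl⟩, hwy⟩ := Metric.mem_closure_iff.1 hy (ε / 2) (by positivity)
  rw [dist_eq_norm] at hwy
  have hcoer : ∀ p, ε / 2 * ‖p‖ - (F w).toReal ≤ J p := by
    intro p
    have h1 := hF.le_realConj (L.adjoint p) hw
    rw [ContinuousLinearMap.adjoint_inner_left, real_inner_comm] at h1
    have h2 : inner ℝ (y - L w) p ≤ ε / 2 * ‖p‖ :=
      (real_inner_le_norm _ _).trans (by gcongr)
    rw [inner_sub_left] at h2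
    simp only [hJ]
    linarith
  have hbdd : BddBelow (range J) := ⟨-(F w).toReal, by
    rintro _ ⟨p, rfl⟩
    have := hcoer p
    have : 0 ≤ ε / 2 * ‖p‖ := by positivity
    linarith⟩
  -- Being a supremum of continuous convex functions, `J` has closed convex sublevel sets.
  have hJle : ∀ r : ℝ, {p | J p ≤ r} = ⋂ (u : E) (_ : F u ≠ ∞),
      {p | inner ℝ p (L u - y) + ε * ‖p‖ ≤ r + (F u).toReal} := by
    intro r
    ext p
    simp only [hJ, mem_ofPred_eq, mem_iInter]
    have : realConj F (L.adjoint p) - inner ℝ y p + ε * ‖p‖ ≤ r ↔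
        realConj F (L.adjoint p) ≤ r + inner ℝ y p - ε * ‖p‖ := by
      constructor <;> intro h <;> linarith
    rw [this, hF.realConj_le_iff]
    refine forall_congr' fun u => forall_congr' fun _ => ?_
    rw [ContinuousLinearMap.adjoint_inner_left, inner_sub_right, real_inner_comm y p]
    constructor <;> intro h <;> linarith
  set δ : ℕ → ℝ := fun n => 1 / ((n : ℝ) + 1) with hδ
  have hδpos : ∀ n, 0 < δ n := fun n => Nat.one_div_pos_of_nat
  have hδanti : Antitone δ := fun n k hnk => Nat.one_div_le_one_div hnk
  have hδlim : Tendsto δ atTop (𝓝 0) := tendsto_one_div_add_atTop_nhds_zero_nat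
  obtain ⟨p, hp⟩ := nonempty_iInter_of_antitone_convex
    (K := fun n => {p | J p ≤ (⨅ p', J p') + δ n})
    (fun n k hnk p hp => le_trans (show J p ≤ (⨅ p', J p') + δ k from hp)
      (add_le_add le_rfl (hδanti hnk)))
    (fun n => by
      obtain ⟨p, hp⟩ := exists_lt_of_ciInf_lt (lt_add_of_pos_right (⨅ p', J p') (hδpos n))
      exact ⟨p, hp.le⟩)
    (fun n => by
      rw [hJle]
      exact isClosed_iInter fun u => isClosed_iInter fun _ =>
        isClosed_le (by fun_prop) continuous_const)
    (fun n => by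
      rw [hJle]
      refine convex_iInter fun u => convex_iInter fun _ => ?_
      have h1 : ConvexOn ℝ univ fun p : X => inner ℝ p (L u - y) := by
        refine ((innerSL ℝ (L u - y)).toLinearMap.convexOn convex_univ).congr fun p _ => ?_
        exact real_inner_comm _ _
      have h2 : ConvexOn ℝ univ fun p : X => ε * ‖p‖ := by
        simpa using (convexOn_norm (convex_univ : Convex ℝ (univ : Set X))).smul hε.le
      simpa using (h1.add h2).convex_le (_ + (F u).toReal))
    (M := ((⨅ p', J p') + δ 0 + (F w).toReal) / (ε / 2))
    (fun p hp => by
      rw [le_div_iff₀ (by positivity)]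
      have := (hcoer p).trans hp
      linarith)
  refine ⟨p, fun p' => ?_⟩
  have hlim : Tendsto (fun n => (⨅ p', J p') + δ n) atTop (𝓝 (⨅ p', J p')) := by
    simpa using hδlim.const_add (⨅ p', J p')
  exact (ge_of_tendsto' hlim hp).trans (ciInf_le hbdd p')

/-- The minimiser of the dual functional is unique. -/
theorem min_dual_unique (L : E →L[ℝ] X) (y : X) {ε : ℝ} (hε : 0 < ε)
    (hy : ∀ p : X, realConj F (L.adjoint p) = 0 → inner ℝ y p ≤ 0) {p₁ p₂ : X}
    (h₁ : ∀ p' : X, realConj F (L.adjoint p₁) - inner ℝ y p₁ + ε * ‖p₁‖ ≤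
      realConj F (L.adjoint p') - inner ℝ y p' + ε * ‖p'‖)
    (h₂ : ∀ p' : X, realConj F (L.adjoint p₂) - inner ℝ y p₂ + ε * ‖p₂‖ ≤
      realConj F (L.adjoint p') - inner ℝ y p' + ε * ‖p'‖) : p₁ = p₂ := by
  have heq := le_antisymm (h₁ p₂) (h₂ p₁)
  -- If the triangle inequality were strict, the midpoint would have a strictly smaller value of
  -- `J`.
  have hray : SameRay ℝ p₁ p₂ := by
    rw [sameRay_iff_norm_add]
    refine le_antisymm (norm_add_le _ _) ?_
    have h := h₁ ((1 / 2 : ℝ) • (p₁ + p₂))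
    have hc := hF.realConj_midpoint_le (L.adjoint p₁) (L.adjoint p₂)
    rw [map_smul, map_add, inner_smul_right, inner_add_right, norm_smul, Real.norm_eq_abs,
      abs_of_pos (by norm_num : (0 : ℝ) < 1 / 2)] at h
    by_contra! hlt
    have := mul_lt_mul_of_pos_left hlt hε
    linarith
  obtain ⟨a, b, ha, hb, hab, hpa, hpb⟩ := hray.exists_eq_smul_add
  set p := p₁ + p₂ with hp
  by_cases hp0 : p = 0
  · rw [hpa, hpb, hp0, smul_zero, smul_zero]
  have hval : ∀ c : ℝ, 0 ≤ c → realConj F (L.adjoint (c • p)) - inner ℝ y (c • p) + ε * ‖c • p‖ =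
      c ^ 2 * realConj F (L.adjoint p) + c * (ε * ‖p‖ - inner ℝ y p) := by
    intro c hc
    rw [map_smul, hF.realConj_smul _ hc, inner_smul_right, norm_smul, Real.norm_eq_abs,
      abs_of_nonneg hc]
    ring
  have hm := h₁ ((1 / 2 : ℝ) • p)
  rw [hpa, hpb, hval a ha, hval b hb] at heq
  rw [hpa, hval a ha, hval _ (by norm_num)] at hm
  set g := realConj F (L.adjoint p) with hg
  set β := ε * ‖p‖ - inner ℝ y p with hβ
  have hg0 : 0 ≤ g := hF.realConj_nonneg _
  have hb' : b = 1 - a := by linarith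
  subst hb'
  -- On the ray, `J (c • p) = c² g + c β`. Comparing the equal values at `a` and `1 - a` with the
  -- value at `1 / 2` gives `(a - 1/2)² g ≤ 0`. If `g = 0`, the dual condition makes `β` positive,
  -- and a nonconstant linear function cannot take equal values at `a` and `1 - a` unless they
  -- coincide.
  have hab' : a = 1 / 2 := by
    by_contra hne
    have hsq : 0 < (a - 1 / 2) ^ 2 := by
      have : a - 1 / 2 ≠ 0 := sub_ne_zero.2 hne
      positivity
    have hg1 : g = 0 := by
      have h3 : (a - 1 / 2) ^ 2 * g ≤ 0 := by nlinarith
      by_contra hgne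
      have : 0 < g := lt_of_le_of_ne hg0 (Ne.symm hgne)
      have := mul_pos hsq this
      linarith
    have hβ0 : 0 < β := by
      have h4 := hy p hg1
      have : 0 < ε * ‖p‖ := mul_pos hε (norm_pos_iff.2 hp0)
      linarith
    rw [hg1] at heq
    have h5 : (2 * a - 1) * β = 0 := by linarith
    rcases mul_eq_zero.1 h5 with h6 | h6
    · exact hne (by linarith)
    · exact hβ0.ne' h6
  rw [hpa, hpb, hab']
  norm_num

/-- At a minimiser of the dual functional, some subgradient steers to the target ball. -/
theorem exists_subgradient_of_min_dual (L : E →L[ℝ] X) (y : X) {ε : ℝ} (hε : 0 ≤ ε) {p : X}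
    (h : ∀ p' : X, realConj F (L.adjoint p) - inner ℝ y p + ε * ‖p‖ ≤
      realConj F (L.adjoint p') - inner ℝ y p' + ε * ‖p'‖) :
    ∃ u ∈ subdifferential (conjugate fun u => (F u : EReal)) (L.adjoint p), ‖L u - y‖ ≤ ε := by
  have h0 := h 0
  simp only [map_zero, hF.realConj_zero, inner_zero_right, norm_zero, mul_zero, sub_zero,
    add_zero] at h0
  obtain ⟨u, hu, huy⟩ := hF.exists_le_of_dual_bound L y hε
    (m := -(realConj F (L.adjoint p) - inner ℝ y p + ε * ‖p‖)) (by linarith)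
    (fun p' => by linarith [h p'])
  refine ⟨u, hF.mem_subdifferential_iff.2 ?_, huy⟩
  have hne : F u ≠ ∞ := ne_top_of_le_ne_top ENNReal.ofReal_ne_top hu
  refine ⟨hne, ?_⟩
  have h1 := (ENNReal.le_ofReal_iff_toReal_le hne (by linarith)).1 hu
  -- Together with `F u ≤ -J p`, this cancels the `ε ‖p‖` term and leaves the Fenchel equality.
  have h2 : inner ℝ (y - L u) p ≤ ε * ‖p‖ := by
    refine (real_inner_le_norm _ _).trans ?_
    rw [norm_sub_rev]
    gcongr
  rw [inner_sub_left] at h2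
  rw [ContinuousLinearMap.adjoint_inner_left, real_inner_comm]
  linarith

end IsQuadCost

end QuadCost

/-! ### The gauge function of a convex set containing 0. -/

section Gauge

variable {H : Type*} [NormedAddCommGroup H] [InnerProductSpace ℝ H] {C : Set H}

theorem gaugeFun_le_of_inv_smul_mem {x : H} {a : ℝ} (ha : 0 < a) (h : a⁻¹ • x ∈ C) :
    gaugeFun C x ≤ ENNReal.ofReal a :=
  iInf₂_le_of_le a ha (iInf_le _ ((mem_smul_set_iff_inv_smul_mem₀ ha.ne' C x).2 h))

/-- Convexity and `0 ∈ C` make membership of `a⁻¹ • x` monotone in `a`. The inequality `r < a` is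
strict because the infimum need not be attained: `C` is not assumed closed, and `r` may be 0. -/
theorem gaugeFun_le_ofReal_iff (hconv : Convex ℝ C) (h0 : (0 : H) ∈ C) {x : H} {r : ℝ}
    (hr : 0 ≤ r) : gaugeFun C x ≤ ENNReal.ofReal r ↔ ∀ a, r < a → a⁻¹ • x ∈ C := by
  constructor
  · intro h a ha
    have ha0 : 0 < a := hr.trans_lt ha
    have h1 : gaugeFun C x < ENNReal.ofReal a :=
      h.trans_lt ((ENNReal.ofReal_lt_ofReal_iff ha0).2 ha)
    simp only [gaugeFun, iInf_lt_iff] at h1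
    obtain ⟨b, hb, hx, hba⟩ := h1
    have hba' : b < a := (ENNReal.ofReal_lt_ofReal_iff ha0).1 hba
    rw [mem_smul_set_iff_inv_smul_mem₀ hb.ne'] at hx
    have h2 := hconv.smul_mem_of_zero_mem h0 hx (t := b / a)
      ⟨by positivity, (div_le_one ha0).2 hba'.le⟩
    rwa [smul_smul, div_mul_eq_mul_div, mul_inv_cancel₀ hb.ne', one_div] at h2
  · intro h
    refine le_of_forall_gt_imp_ge_of_dense fun m hm => ?_
    induction m using ENNReal.recTopCoe with
    | top => exact le_top
    | coe m =>
      have hm' : r < m := by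
        rw [← ENNReal.ofReal_coe_nnreal] at hm
        exact (ENNReal.ofReal_lt_ofReal_iff_of_nonneg hr).1 hm
      rw [← ENNReal.ofReal_coe_nnreal]
      exact gaugeFun_le_of_inv_smul_mem (hr.trans_lt hm') (h m hm')

theorem inv_smul_mem_of_gaugeFun_le (hcl : IsClosed C) (hconv : Convex ℝ C) (h0 : (0 : H) ∈ C)
    {x : H} {r : ℝ} (hr : 0 < r) (h : gaugeFun C x ≤ ENNReal.ofReal r) : r⁻¹ • x ∈ C := by
  have hlim : Tendsto (fun a : ℝ => a⁻¹ • x) (𝓝[>] r) (𝓝 (r⁻¹ • x)) :=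
    ((tendsto_inv₀ hr.ne').smul_const x).mono_left nhdsWithin_le_nhds
  exact hcl.mem_of_tendsto hlim
    (eventually_mem_nhdsWithin.mono ((gaugeFun_le_ofReal_iff hconv h0 hr.le).1 h))

theorem mem_genCone_of_gaugeFun_ne_top {x : H} (h : gaugeFun C x ≠ ∞) : x ∈ genCone C := by
  have h1 : gaugeFun C x < ∞ := lt_top_iff_ne_top.2 h
  simp only [gaugeFun, iInf_lt_iff] at h1
  obtain ⟨a, ha, ⟨p, hp, rfl⟩, -⟩ := h1
  exact ⟨a, ha, p, hp, rfl⟩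

theorem gaugeFun_zero (h0 : (0 : H) ∈ C) : gaugeFun C 0 = 0 := by
  refine le_antisymm (le_of_forall_gt_imp_ge_of_dense fun m hm => ?_) bot_le
  induction m using ENNReal.recTopCoe with
  | top => exact le_top
  | coe m =>
    rw [← ENNReal.ofReal_coe_nnreal]
    exact gaugeFun_le_of_inv_smul_mem (by exact_mod_cast hm) (by simpa using h0)

theorem gaugeFun_smul_le (x : H) {l : ℝ} (hl : 0 < l) :
    gaugeFun C (l • x) ≤ ENNReal.ofReal l * gaugeFun C x := by
  rw [gaugeFun, gaugeFun, ENNReal.mul_iInf_of_ne (by simpa using hl) ENNReal.ofReal_ne_top]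
  refine le_iInf fun a => ?_
  rw [ENNReal.mul_iInf_of_ne (by simpa using hl) ENNReal.ofReal_ne_top]
  refine le_iInf fun ha => ?_
  rw [ENNReal.mul_iInf_of_ne (by simpa using hl) ENNReal.ofReal_ne_top]
  refine le_iInf fun hx => ?_
  rw [← ENNReal.ofReal_mul hl.le]
  refine gaugeFun_le_of_inv_smul_mem (mul_pos hl ha) ?_
  rw [mem_smul_set_iff_inv_smul_mem₀ ha.ne'] at hx
  rwa [smul_smul, mul_inv_rev, mul_assoc, inv_mul_cancel₀ hl.ne', mul_one]

theorem gaugeFun_smul (x : H) {l : ℝ} (hl : 0 < l) :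
    gaugeFun C (l • x) = ENNReal.ofReal l * gaugeFun C x := by
  refine le_antisymm (gaugeFun_smul_le x hl) ?_
  have h := gaugeFun_smul_le (C := C) (l • x) (inv_pos.2 hl)
  rw [smul_smul, inv_mul_cancel₀ hl.ne', one_smul] at h
  calc ENNReal.ofReal l * gaugeFun C x
      ≤ ENNReal.ofReal l * (ENNReal.ofReal l⁻¹ * gaugeFun C (l • x)) := by gcongr
    _ = gaugeFun C (l • x) := by
      rw [← mul_assoc, ← ENNReal.ofReal_mul hl.le, mul_inv_cancel₀ hl.ne', ENNReal.ofReal_one,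
        one_mul]

theorem isClosed_gaugeFun_le (hcl : IsClosed C) (hconv : Convex ℝ C) (h0 : (0 : H) ∈ C)
    (m : ℝ≥0∞) : IsClosed {x | gaugeFun C x ≤ m} := by
  induction m using ENNReal.recTopCoe with
  | top => simp
  | coe m =>
    have : {x | gaugeFun C x ≤ m} = ⋂ (a : ℝ) (_ : (m : ℝ) < a), (fun x => a⁻¹ • x) ⁻¹' C := by
      ext x
      rw [← ENNReal.ofReal_coe_nnreal]
      simpa using gaugeFun_le_ofReal_iff hconv h0 m.2
    rw [this]
    exact isClosed_iInter fun a => isClosed_iInter fun _ => hcl.preimage (by fun_prop)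

theorem lowerSemicontinuous_gaugeFun (hcl : IsClosed C) (hconv : Convex ℝ C) (h0 : (0 : H) ∈ C) :
    LowerSemicontinuous (gaugeFun C) :=
  lowerSemicontinuous_iff_isClosed_preimage.2 (isClosed_gaugeFun_le hcl hconv h0)

theorem gaugeFun_convex (hconv : Convex ℝ C) (h0 : (0 : H) ∈ C) (x y : H) {a b : ℝ}
    (ha : 0 < a) (hb : 0 < b) (hab : a + b = 1) :
    gaugeFun C (a • x + b • y) ≤
      ENNReal.ofReal a * gaugeFun C x + ENNReal.ofReal b * gaugeFun C y := by
  have ha' : ENNReal.ofReal a ≠ 0 := by simpa using ha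
  have hb' : ENNReal.ofReal b ≠ 0 := by simpa using hb
  by_cases hx : gaugeFun C x = ∞
  · simp [hx, ENNReal.mul_top ha']
  by_cases hy : gaugeFun C y = ∞
  · simp [hy, ENNReal.mul_top hb']
  set r := (gaugeFun C x).toReal with hr
  set s := (gaugeFun C y).toReal with hs
  have hr0 : 0 ≤ r := ENNReal.toReal_nonneg
  have hs0 : 0 ≤ s := ENNReal.toReal_nonneg
  have hxr : gaugeFun C x = ENNReal.ofReal r := (ENNReal.ofReal_toReal hx).symm
  have hys : gaugeFun C y = ENNReal.ofReal s := (ENNReal.ofReal_toReal hy).symm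
  rw [hxr, hys, ← ENNReal.ofReal_mul ha.le, ← ENNReal.ofReal_mul hb.le,
    ← ENNReal.ofReal_add (by positivity) (by positivity),
    gaugeFun_le_ofReal_iff hconv h0 (by positivity)]
  intro t ht
  have hδ : 0 < t - (a * r + b * s) := sub_pos.2 ht
  have ht0 : 0 < t := by have := mul_nonneg ha.le hr0; have := mul_nonneg hb.le hs0; linarith
  -- Giving the whole slack to both radii keeps them positive, and `a r' + b s' = t` because `a + b
  -- = 1`.
  set r' := r + (t - (a * r + b * s)) with hr'
  set s' := s + (t - (a * r + b * s)) with hs'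
  have hrp : 0 < r' := by linarith
  have hsp : 0 < s' := by linarith
  have h1 := (gaugeFun_le_ofReal_iff hconv h0 hr0).1 hxr.le r' (by linarith)
  have h2 := (gaugeFun_le_ofReal_iff hconv h0 hs0).1 hys.le s' (by linarith)
  have h3 : a * r' + b * s' = t := by
    rw [hr', hs']
    linear_combination (t - (a * r + b * s)) * hab
  have h4 := hconv h1 h2 (a := t⁻¹ * (a * r')) (b := t⁻¹ * (b * s')) (by positivity)
    (by positivity) (by rw [← mul_add, h3, inv_mul_cancel₀ ht0.ne'])
  rw [smul_smul, smul_smul] at h4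
  rw [smul_add, smul_smul, smul_smul]
  convert h4 using 3 <;> field_simp

theorem gaugeFun_sq_convex (hconv : Convex ℝ C) (h0 : (0 : H) ∈ C) (x y : H) {a b : ℝ}
    (ha : 0 ≤ a) (hb : 0 ≤ b) (hab : a + b = 1) :
    gaugeFun C (a • x + b • y) ^ 2 ≤
      ENNReal.ofReal a * gaugeFun C x ^ 2 + ENNReal.ofReal b * gaugeFun C y ^ 2 := by
  rcases ha.eq_or_lt with rfl | ha
  · obtain rfl : b = 1 := by linarith
    simp
  rcases hb.eq_or_lt with rfl | hb
  · obtain rfl : a = 1 := by linarith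
    simp
  refine (pow_le_pow_left' (gaugeFun_convex hconv h0 x y ha hb hab) 2).trans ?_
  have := ENNReal.rpow_arith_mean_le_arith_mean2_rpow (ENNReal.ofReal a) (ENNReal.ofReal b)
    (gaugeFun C x) (gaugeFun C y)
    (by rw [← ENNReal.ofReal_add ha.le hb.le, hab, ENNReal.ofReal_one]) (p := 2) (by norm_num)
  exact_mod_cast this

theorem inner_le_mul_of_gaugeFun_le (hconv : Convex ℝ C) (h0 : (0 : H) ∈ C) {q x : H} {r s : ℝ}
    (hr : 0 ≤ r) (hx : gaugeFun C x ≤ ENNReal.ofReal r) (hs : ∀ c ∈ C, inner ℝ q c ≤ s) :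
    inner ℝ q x ≤ r * s := by
  have hlim : Tendsto (fun a : ℝ => a * s) (𝓝[>] r) (𝓝 (r * s)) :=
    ((continuous_id.mul continuous_const).tendsto r).mono_left nhdsWithin_le_nhds
  refine ge_of_tendsto hlim (eventually_mem_nhdsWithin.mono fun a ha => ?_)
  have ha0 : 0 < a := hr.trans_lt ha
  have h1 := hs _ ((gaugeFun_le_ofReal_iff hconv h0 hr).1 hx a ha)
  rwa [inner_smul_right, inv_mul_le_iff₀ ha0] at h1

theorem norm_le_mul_of_gaugeFun_le (hconv : Convex ℝ C) (h0 : (0 : H) ∈ C) {x : H} {r M : ℝ}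
    (hr : 0 ≤ r) (hx : gaugeFun C x ≤ ENNReal.ofReal r) (hM : ∀ c ∈ C, ‖c‖ ≤ M) :
    ‖x‖ ≤ r * M := by
  by_cases hx0 : x = 0
  · subst hx0
    rw [norm_zero]
    exact mul_nonneg hr ((norm_nonneg _).trans (hM 0 h0))
  have hx0' : 0 < ‖x‖ := norm_pos_iff.2 hx0
  -- The support inequality is tested in the direction of `x` itself.
  have h := inner_le_mul_of_gaugeFun_le hconv h0 (q := x) hr hx (s := ‖x‖ * M) fun c hc =>
    (real_inner_le_norm x c).trans (mul_le_mul_of_nonneg_left (hM c hc) hx0'.le)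
  rw [real_inner_self_eq_norm_sq] at h
  exact le_of_mul_le_mul_left (by linarith) hx0'

end Gauge

/-! ### Measurable selection of maximisers of linear forms. -/

section Maximizer

variable {H : Type*} [NormedAddCommGroup H] [InnerProductSpace ℝ H] [CompleteSpace H] {C : Set H}

/-- The metric projection is nonexpansive: add its variational inequalities at `y` and at `z`. -/
theorem exists_continuous_projection (hcl : IsClosed C) (hconv : Convex ℝ C) (hne : C.Nonempty) :
    ∃ P : H → H, Continuous P ∧ ∀ y, P y ∈ C ∧ ∀ w ∈ C, inner ℝ (y - P y) (w - P y) ≤ 0 := by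
  choose P hP hmin using exists_norm_eq_iInf_of_complete_convex hne hcl.isComplete hconv
  have hvar := fun y => (norm_eq_iInf_iff_real_inner_le_zero hconv (hP y)).1 (hmin y)
  refine ⟨P, ?_, fun y => ⟨hP y, hvar y⟩⟩
  refine (LipschitzWith.of_dist_le_mul (K := 1) fun y z => ?_).continuous
  rw [dist_eq_norm, dist_eq_norm, NNReal.coe_one, one_mul]
  have h1 := hvar y (P z) (hP z)
  have h2 := hvar z (P y) (hP y)
  have h3 := real_inner_le_norm (y - z) (P y - P z)
  have h4 : ‖P y - P z‖ ^ 2 ≤ inner ℝ (y - z) (P y - P z) := by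
    rw [← real_inner_self_eq_norm_sq]
    have e1 : inner ℝ (y - P y) (P z - P y) = -inner ℝ (y - P y) (P y - P z) := by
      rw [← inner_neg_right, neg_sub]
    have e2 : (y - z) = (y - P y) - (z - P z) + (P y - P z) := by abel
    rw [e2, inner_add_left (_ - _), inner_sub_left (y - P y)]
    linarith
  by_contra! hlt
  nlinarith [norm_nonneg (y - z)]

/-- A selection of the maximisers of linear forms over a bounded closed convex set, nearest to a
given point, and obtained as a pointwise limit of continuous maps. -/
theorem exists_maximizer_selection (hcl : IsClosed C) (hconv : Convex ℝ C) (h0 : (0 : H) ∈ C)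
    {M : ℝ} (hM : ∀ c ∈ C, ‖c‖ ≤ M) (x : H) :
    ∃ (f : ℕ → H → H) (g : H → H), (∀ n, Continuous (f n)) ∧
      (∀ v, Tendsto (fun n => f n v) atTop (𝓝 (g v))) ∧ (∀ v, g v ∈ C) ∧
      (∀ v, ∀ c ∈ C, inner ℝ v c ≤ inner ℝ v (g v)) ∧
      ∀ v, ∀ c ∈ C, inner ℝ v (g v) ≤ inner ℝ v c → ‖g v - x‖ ≤ ‖c - x‖ := by
  obtain ⟨P, hPc, hP⟩ := exists_continuous_projection hcl hconv ⟨0, h0⟩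
  -- This is Tikhonov regularisation: projecting `x + n v` maximises `n ⟪v, c⟫ - ½ ‖c - x‖²` over `c
  -- ∈ C`, so the limit maximises `⟪v, ·⟫` and, among maximisers, is nearest to `x`.
  set f : ℕ → H → H := fun n v => P (x + (n : ℝ) • v) with hf
  have hfC : ∀ n v, f n v ∈ C := fun n v => (hP _).1
  have hvar : ∀ (n : ℕ) v, ∀ w ∈ C,
      (n : ℝ) * inner ℝ v (w - f n v) ≤ inner ℝ (f n v - x) (w - f n v) := by
    intro n v w hw
    have h := (hP (x + (n : ℝ) • v)).2 w hw
    have e : x + (n : ℝ) • v - f n v = (n : ℝ) • v - (f n v - x) := by abel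
    change inner ℝ (x + (n : ℝ) • v - f n v) (w - f n v) ≤ 0 at h
    rw [e, inner_sub_left, real_inner_smul_left] at h
    linarith
  have hbd : ∀ n v, ‖f n v - x‖ ≤ M + ‖x‖ := fun n v =>
    (norm_sub_le _ _).trans (by linarith [hM _ (hfC n v)])
  have hlim : ∀ v, ∃ y, Tendsto (fun n => f n v) atTop (𝓝 y) := by
    intro v
    refine exists_tendsto_of_sq_dist_le (a := fun n => ‖f n v - x‖ ^ 2) (M := (M + ‖x‖) ^ 2)
      (fun n => pow_le_pow_left₀ (norm_nonneg _) (hbd n v) 2) (fun n m hnm => ?_)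
    have h1 := hvar n v _ (hfC m v)
    have h2 := hvar m v _ (hfC n v)
    have hnm' : (n : ℝ) ≤ m := by exact_mod_cast hnm
    have hn0 : (0 : ℝ) ≤ n := Nat.cast_nonneg n
    set d := f m v - f n v with hd
    have e1 : f n v - f m v = -d := by rw [hd]; abel
    have e2 : f m v - x = d + (f n v - x) := by rw [hd]; abel
    rw [e1, inner_neg_right, inner_neg_right, e2, inner_add_left,
      real_inner_self_eq_norm_sq] at h2
    rw [e2, @norm_add_sq_real, real_inner_comm (f n v - x) d]
    -- Adding `h1` and `h2` gives `‖d‖² ≤ (m - n) ⟪v, d⟫`. With this sign, `h1` shows that `‖f n v -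
    -- x‖²` grows by at least `‖d‖²`.
    have hS : 0 ≤ inner ℝ v d := by
      rcases hnm'.eq_or_lt with h | h
      · have hnm2 : n = m := by exact_mod_cast h
        subst hnm2
        simp [hd]
      · by_contra! hneg
        nlinarith [sq_nonneg ‖d‖]
    have := mul_nonneg hn0 hS
    linarith
  choose g hg using hlim
  have hmaxi : ∀ v, ∀ c ∈ C, inner ℝ v c ≤ inner ℝ v (g v) := by
    intro v c hc
    have h1 : Tendsto (fun n : ℕ => inner ℝ v (c - f n v) - (M + ‖x‖) * (M + M) / n) atTop
        (𝓝 (inner ℝ v (c - g v) - 0)) :=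
      (((continuous_const.inner (continuous_const.sub continuous_id)).tendsto (g v)).comp
        (hg v)).sub (tendsto_const_div_atTop_nhds_zero_nat _)
    have h2 : inner ℝ v (c - g v) - 0 ≤ 0 := by
      refine le_of_tendsto h1 ((eventually_gt_atTop 0).mono fun n hn => ?_)
      have hn' : (0 : ℝ) < n := by exact_mod_cast hn
      rw [sub_nonpos, le_div_iff₀ hn', mul_comm]
      refine ((hvar n v c hc).trans (real_inner_le_norm _ _)).trans ?_
      have hM0 : 0 ≤ M := (norm_nonneg _).trans (hM _ hc)
      exact mul_le_mul (hbd n v)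
        ((norm_sub_le _ _).trans (add_le_add (hM _ hc) (hM _ (hfC n v)))) (norm_nonneg _)
        (by positivity)
    rw [inner_sub_right] at h2
    linarith
  refine ⟨f, g, fun n => hPc.comp (by fun_prop), hg,
    fun v => hcl.mem_of_tendsto (hg v) (Eventually.of_forall fun n => hfC n v), hmaxi,
    fun v c hc hmax => ?_⟩
  refine le_of_tendsto (((hg v).sub_const x).norm) (Eventually.of_forall fun n => ?_)
  have hgmax : inner ℝ v (f n v) ≤ inner ℝ v c := (hmaxi v _ (hfC n v)).trans hmax
  have h1 := hvar n v c hc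
  have h2 : 0 ≤ (n : ℝ) * inner ℝ v (c - f n v) := by
    rw [inner_sub_right]
    exact mul_nonneg (Nat.cast_nonneg n) (sub_nonneg.2 hgmax)
  have e : c - x = (f n v - x) + (c - f n v) := by abel
  have h3 : ‖f n v - x‖ ^ 2 ≤ ‖c - x‖ ^ 2 := by
    rw [e, @norm_add_sq_real]
    linarith [sq_nonneg ‖c - f n v‖]
  exact le_of_sq_le_sq h3 (norm_nonneg _)

end Maximizer

/-! ### The integral cost on `L²` and its subgradients. -/

section GaugeCost

variable {α : Type*} [MeasurableSpace α] {μ : Measure α}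
  {U : Type*} [NormedAddCommGroup U] [InnerProductSpace ℝ U] {C : Set U}

/-- The cost `½ ∫ j_C(u)²` on `L²`. -/
noncomputable def gaugeCost (C : Set U) (μ : Measure α) (u : Lp U 2 μ) : ℝ≥0∞ :=
  (1 / 2 : ℝ≥0∞) * ∫⁻ t, gaugeFun C (u t) ^ 2 ∂μ

theorem one_half_eq_ofReal : (1 / 2 : ℝ≥0∞) = ENNReal.ofReal (1 / 2) := by
  rw [ENNReal.ofReal_div_of_pos (by norm_num)]; simp

theorem aemeasurable_gaugeFun_sq (hcl : IsClosed C) (hconv : Convex ℝ C) (h0 : (0 : U) ∈ C)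
    (u : Lp U 2 μ) : AEMeasurable (fun t => gaugeFun C (u t) ^ 2) μ := by
  borelize U
  exact ((lowerSemicontinuous_gaugeFun hcl hconv h0).measurable.comp_aemeasurable
    (Lp.aestronglyMeasurable u).aemeasurable).pow_const 2

/-- Fatou's lemma along an almost everywhere convergent subsequence, combined with lower
semicontinuity of the gauge. -/
theorem isClosed_gaugeCost_le (hcl : IsClosed C) (hconv : Convex ℝ C) (h0 : (0 : U) ∈ C)
    (m : ℝ≥0∞) : IsClosed {u : Lp U 2 μ | gaugeCost C μ u ≤ m} := by
  refine IsSeqClosed.isClosed fun u v hu huv => ?_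
  obtain ⟨ns, -, hns⟩ := (tendstoInMeasure_of_tendsto_Lp huv).exists_seq_tendsto_ae
  have hlsc : LowerSemicontinuous fun x => gaugeFun C x ^ 2 :=
    (ENNReal.continuous_pow 2).comp_lowerSemicontinuous (lowerSemicontinuous_gaugeFun hcl hconv h0)
      fun a b hab => pow_le_pow_left' hab 2
  have h1 : ∫⁻ t, gaugeFun C (v t) ^ 2 ∂μ ≤
      liminf (fun i => ∫⁻ t, gaugeFun C (u (ns i) t) ^ 2 ∂μ) atTop := by
    refine le_trans (lintegral_mono_ae ?_)
      (lintegral_liminf_le' fun i => aemeasurable_gaugeFun_sq hcl hconv h0 (u (ns i)))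
    filter_upwards [hns] with t ht
    refine (lowerSemicontinuousAt_iff_le_liminf.1 (hlsc (v t))).trans ?_
    exact liminf_le_liminf_of_le ht
  have hu' : ∀ i, ∫⁻ t, gaugeFun C (u i t) ^ 2 ∂μ ≤ 2 * m := by
    intro i
    have h2 : (1 / 2 : ℝ≥0∞) * ∫⁻ t, gaugeFun C (u i t) ^ 2 ∂μ ≤ m := hu i
    calc ∫⁻ t, gaugeFun C (u i t) ^ 2 ∂μ
        = 2 * ((1 / 2 : ℝ≥0∞) * ∫⁻ t, gaugeFun C (u i t) ^ 2 ∂μ) := by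
          rw [← mul_assoc, one_div, ENNReal.mul_inv_cancel (by norm_num) (by norm_num), one_mul]
      _ ≤ 2 * m := by gcongr
  have h3 : ∫⁻ t, gaugeFun C (v t) ^ 2 ∂μ ≤ 2 * m :=
    h1.trans (liminf_le_of_frequently_le' (Frequently.of_forall fun i => hu' (ns i)))
  calc (1 / 2 : ℝ≥0∞) * ∫⁻ t, gaugeFun C (v t) ^ 2 ∂μ ≤ 1 / 2 * (2 * m) := by gcongr
    _ = m := by
      rw [← mul_assoc, one_div, ENNReal.inv_mul_cancel (by norm_num) (by norm_num), one_mul]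

theorem isQuadCost_gaugeCost (hcl : IsClosed C) (hconv : Convex ℝ C) (h0 : (0 : U) ∈ C)
    {M : ℝ} (hM0 : 0 < M) (hM : ∀ c ∈ C, ‖c‖ ≤ M) : IsQuadCost (gaugeCost C μ) where
  zero := by
    have : ∫⁻ t, gaugeFun C ((0 : Lp U 2 μ) t) ^ 2 ∂μ = ∫⁻ _, 0 ∂μ := by
      refine lintegral_congr_ae ?_
      filter_upwards [Lp.coeFn_zero U 2 μ] with t ht
      rw [ht, Pi.zero_apply, gaugeFun_zero h0]
      simp
    rw [gaugeCost, this]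
    simp
  smul a ha u := by
    have : ∫⁻ t, gaugeFun C ((a • u : Lp U 2 μ) t) ^ 2 ∂μ =
        ∫⁻ t, ENNReal.ofReal (a ^ 2) * gaugeFun C (u t) ^ 2 ∂μ := by
      refine lintegral_congr_ae ?_
      filter_upwards [Lp.coeFn_smul a u] with t ht
      rw [ht, Pi.smul_apply, gaugeFun_smul _ ha, mul_pow, ENNReal.ofReal_pow ha.le]
    rw [gaugeCost, this, lintegral_const_mul' _ _ ENNReal.ofReal_ne_top, gaugeCost]
    ring
  isClosed := isClosed_gaugeCost_le hcl hconv h0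
  convex m := by
    intro u hu v hv a b ha hb hab
    have h1 : ∫⁻ t, gaugeFun C ((a • u + b • v : Lp U 2 μ) t) ^ 2 ∂μ ≤
        ENNReal.ofReal a * ∫⁻ t, gaugeFun C (u t) ^ 2 ∂μ +
          ENNReal.ofReal b * ∫⁻ t, gaugeFun C (v t) ^ 2 ∂μ := by
      rw [← lintegral_const_mul' _ _ ENNReal.ofReal_ne_top,
        ← lintegral_const_mul' _ _ ENNReal.ofReal_ne_top,
        ← lintegral_add_left' ((aemeasurable_gaugeFun_sq hcl hconv h0 u).const_mul _)]
      refine lintegral_mono_ae ?_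
      filter_upwards [Lp.coeFn_add (a • u) (b • v), Lp.coeFn_smul a u, Lp.coeFn_smul b v]
        with t h1 h2 h3
      rw [h1, Pi.add_apply, h2, h3, Pi.smul_apply, Pi.smul_apply]
      exact gaugeFun_sq_convex hconv h0 _ _ ha hb hab
    calc gaugeCost C μ (a • u + b • v)
        ≤ 1 / 2 * (ENNReal.ofReal a * ∫⁻ t, gaugeFun C (u t) ^ 2 ∂μ +
          ENNReal.ofReal b * ∫⁻ t, gaugeFun C (v t) ^ 2 ∂μ) := by rw [gaugeCost]; gcongr
      _ = ENNReal.ofReal a * gaugeCost C μ u + ENNReal.ofReal b * gaugeCost C μ v := by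
        rw [gaugeCost, gaugeCost]; ring
      _ ≤ ENNReal.ofReal a * m + ENNReal.ofReal b * m := by
        gcongr
        · exact hu
        · exact hv
      _ = m := by
        rw [← add_mul, ← ENNReal.ofReal_add ha hb, hab, ENNReal.ofReal_one, one_mul]
  coercive := by
    -- The constant comes from `‖x‖ ≤ M j(x)` and the factor `½` in the cost.
    refine ⟨1 / (2 * M ^ 2), by positivity, fun u => ?_⟩
    have hint : Integrable (fun t => 1 / (2 * M ^ 2) * inner ℝ (u t) (u t)) μ :=
      (L2.integrable_inner (𝕜 := ℝ) u u).const_mul _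
    have hnn : 0 ≤ᵐ[μ] fun t => 1 / (2 * M ^ 2) * inner ℝ (u t) (u t) :=
      Eventually.of_forall fun t => mul_nonneg (by positivity) real_inner_self_nonneg
    have h1 : 1 / (2 * M ^ 2) * ‖u‖ ^ 2 = ∫ t, 1 / (2 * M ^ 2) * inner ℝ (u t) (u t) ∂μ := by
      rw [integral_const_mul, ← real_inner_self_eq_norm_sq, L2.inner_def]
    rw [h1, ofReal_integral_eq_lintegral_ofReal hint hnn, gaugeCost,
      ← lintegral_const_mul' _ _ (by simp)]
    refine lintegral_mono fun t => ?_
    by_cases hj : gaugeFun C (u t) = ∞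
    · simp [hj]
    · have h2 := norm_le_mul_of_gaugeFun_le hconv h0 ENNReal.toReal_nonneg
        (ENNReal.ofReal_toReal hj).ge hM
      rw [← ENNReal.ofReal_toReal hj, one_half_eq_ofReal, ← ENNReal.ofReal_pow
        ENNReal.toReal_nonneg, ← ENNReal.ofReal_mul (by norm_num), real_inner_self_eq_norm_sq]
      refine ENNReal.ofReal_le_ofReal ?_
      have h3 : ‖u t‖ ^ 2 ≤ ((gaugeFun C (u t)).toReal * M) ^ 2 :=
        pow_le_pow_left₀ (norm_nonneg _) h2 2
      rw [div_mul_eq_mul_div, div_le_iff₀ (by positivity)]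
      linarith

theorem ae_gaugeFun_ne_top (hcl : IsClosed C) (hconv : Convex ℝ C) (h0 : (0 : U) ∈ C)
    {u : Lp U 2 μ} (hu : gaugeCost C μ u ≠ ∞) : ∀ᵐ t ∂μ, gaugeFun C (u t) ≠ ∞ := by
  have h1 : ∫⁻ t, gaugeFun C (u t) ^ 2 ∂μ ≠ ∞ := fun h => hu (by
    rw [gaugeCost, h]; exact ENNReal.mul_top (by simp))
  filter_upwards [ae_lt_top' (aemeasurable_gaugeFun_sq hcl hconv h0 u) h1] with t ht h
  rw [h] at ht
  simp at ht

theorem integrable_gaugeFun_sq (hcl : IsClosed C) (hconv : Convex ℝ C) (h0 : (0 : U) ∈ C)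
    {u : Lp U 2 μ} (hu : gaugeCost C μ u ≠ ∞) :
    Integrable (fun t => (gaugeFun C (u t)).toReal ^ 2) μ := by
  have h1 : ∫⁻ t, gaugeFun C (u t) ^ 2 ∂μ ≠ ∞ := fun h => hu (by
    rw [gaugeCost, h]; exact ENNReal.mul_top (by simp))
  simpa only [ENNReal.toReal_pow] using
    integrable_toReal_of_lintegral_ne_top (aemeasurable_gaugeFun_sq hcl hconv h0 u) h1

theorem toReal_gaugeCost (hcl : IsClosed C) (hconv : Convex ℝ C) (h0 : (0 : U) ∈ C)
    {u : Lp U 2 μ} (hu : gaugeCost C μ u ≠ ∞) :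
    (gaugeCost C μ u).toReal = 1 / 2 * ∫ t, (gaugeFun C (u t)).toReal ^ 2 ∂μ := by
  have h1 := integral_toReal (aemeasurable_gaugeFun_sq hcl hconv h0 u)
    ((ae_gaugeFun_ne_top hcl hconv h0 hu).mono fun t ht => ENNReal.pow_lt_top ht.lt_top)
  simp only [ENNReal.toReal_pow] at h1
  rw [gaugeCost, ENNReal.toReal_mul, ← h1]
  simp

theorem gaugeCost_le_of_ae_le {u : Lp U 2 μ} {s : α → ℝ} (hs : Integrable (fun t => s t ^ 2) μ)
    (h : ∀ᵐ t ∂μ, 0 ≤ s t ∧ gaugeFun C (u t) ≤ ENNReal.ofReal (s t)) :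
    gaugeCost C μ u ≤ ENNReal.ofReal (1 / 2 * ∫ t, s t ^ 2 ∂μ) := by
  rw [gaugeCost, ENNReal.ofReal_mul (by norm_num), ← one_half_eq_ofReal,
    ofReal_integral_eq_lintegral_ofReal hs (Eventually.of_forall fun t => sq_nonneg _)]
  refine mul_le_mul_right (lintegral_mono_ae ?_) _
  filter_upwards [h] with t ht
  rw [ENNReal.ofReal_pow ht.1]
  exact pow_le_pow_left' ht.2 2

/-- Composing an `L²` function `q` with a selection `g` of maximisers gives the `L²` control
`⟪q, g(q)⟫ g(q)`. -/
theorem exists_control_of_selection {M : ℝ} (hM0 : 0 ≤ M) {f : ℕ → U → U} {g : U → U}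
    (hf : ∀ n, Continuous (f n)) (hfg : ∀ v, Tendsto (fun n => f n v) atTop (𝓝 (g v)))
    (hg : ∀ v, ‖g v‖ ≤ M) (q : Lp U 2 μ) :
    ∃ u : Lp U 2 μ, ∀ᵐ t ∂μ, u t = inner ℝ (q t) (g (q t)) • g (q t) := by
  have hq := Lp.aestronglyMeasurable q
  have hgq : AEStronglyMeasurable (fun t => g (q t)) μ :=
    aestronglyMeasurable_of_tendsto_ae atTop
      (fun n => (hf n).comp_aestronglyMeasurable hq) (Eventually.of_forall fun t => hfg (q t))
  have hmem : MemLp (fun t => inner ℝ (q t) (g (q t)) • g (q t)) 2 μ := by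
    refine (Lp.memLp q).of_le_mul (c := M * M) ((hq.inner hgq).smul hgq)
      (Eventually.of_forall fun t => ?_)
    rw [norm_smul]
    calc ‖inner ℝ (q t) (g (q t))‖ * ‖g (q t)‖ ≤ (‖q t‖ * ‖g (q t)‖) * ‖g (q t)‖ := by
          gcongr; exact norm_inner_le_norm _ _
      _ ≤ (‖q t‖ * M) * M := by gcongr <;> exact hg _
      _ = M * M * ‖q t‖ := by ring
  exact ⟨hmem.toLp _, hmem.coeFn_toLp⟩

/-- With `s = ⟪q, c⟫ ≥ 0`, the control `s c` has gauge at most `s`, while `⟪q, s c⟫ = s²`. -/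
theorem gaugeCost_le_of_ae_maximizer (h0 : (0 : U) ∈ C) {q u : Lp U 2 μ}
    (h : ∀ᵐ t ∂μ, ∃ c ∈ C, (∀ z ∈ C, inner ℝ (q t) z ≤ inner ℝ (q t) c) ∧
      u t = inner ℝ (q t) c • c) :
    gaugeCost C μ u ≤ ENNReal.ofReal (1 / 2 * inner ℝ q u) := by
  have hint := L2.integrable_inner (𝕜 := ℝ) q u
  have hsq : ∀ᵐ t ∂μ, 0 ≤ inner ℝ (q t) (u t) ∧
      gaugeFun C (u t) ≤ ENNReal.ofReal (√(inner ℝ (q t) (u t))) := by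
    filter_upwards [h] with t ⟨c, hc, hmax, hut⟩
    have hs : 0 ≤ inner ℝ (q t) c := by simpa using hmax 0 h0
    rw [hut, inner_smul_right, Real.sqrt_mul_self hs]
    refine ⟨mul_self_nonneg _, ?_⟩
    rcases hs.eq_or_lt with h1 | h1
    · rw [← h1, zero_smul, gaugeFun_zero h0]
      simp
    · refine gaugeFun_le_of_inv_smul_mem h1 ?_
      rwa [smul_smul, inv_mul_cancel₀ h1.ne', one_smul]
  have hcongr : (fun t => √(inner ℝ (q t) (u t)) ^ 2) =ᵐ[μ] fun t => inner ℝ (q t) (u t) := by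
    filter_upwards [hsq] with t ht using Real.sq_sqrt ht.1
  have := gaugeCost_le_of_ae_le (hint.congr hcongr.symm)
    (hsq.mono fun t ht => ⟨Real.sqrt_nonneg _, ht.2⟩)
  rwa [integral_congr_ae hcongr, ← L2.inner_def (𝕜 := ℝ)] at this

theorem inner_le_gaugeFun_mul_of_maximizer (hconv : Convex ℝ C) (h0 : (0 : U) ∈ C) {q c x : U}
    (hmax : ∀ z ∈ C, inner ℝ q z ≤ inner ℝ q c) (hx : gaugeFun C x ≠ ∞) :
    inner ℝ q x ≤ (gaugeFun C x).toReal * inner ℝ q c :=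
  inner_le_mul_of_gaugeFun_le hconv h0 ENNReal.toReal_nonneg (ENNReal.ofReal_toReal hx).ge hmax

variable [CompleteSpace U]

/-- The subgradients of the conjugate cost are the controls which are almost everywhere of the form
`⟪q, c⟫ c` with `c` maximising `⟪q, ·⟫` over `C`. -/
theorem mem_subdifferential_gaugeCost_iff (hcl : IsClosed C) (hconv : Convex ℝ C)
    (h0 : (0 : U) ∈ C) {M : ℝ} (hM0 : 0 < M) (hM : ∀ c ∈ C, ‖c‖ ≤ M) {q u : Lp U 2 μ} :
    u ∈ subdifferential (conjugate fun u => (gaugeCost C μ u : EReal)) q ↔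
      ∀ᵐ t ∂μ, ∃ c ∈ C, (∀ z ∈ C, inner ℝ (q t) z ≤ inner ℝ (q t) c) ∧
        u t = inner ℝ (q t) c • c := by
  have hF := isQuadCost_gaugeCost (μ := μ) hcl hconv h0 hM0 hM
  rw [hF.mem_subdifferential_iff]
  obtain ⟨f, g, hf, hfg, hgC, hgmax, -⟩ := exists_maximizer_selection hcl hconv h0 hM 0
  constructor
  · rintro ⟨hu, hle⟩
    -- Since `w` gives `F* q ≥ ½ ⟪q, w⟫`, the Fenchel equality forces the integral of `½ j² + ½ s² -
    -- ⟪q, u⟫` to be nonpositive. The integrand is at least `½ (j - s)²`, so it vanishes almost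
    -- everywhere and `j = s`.
    obtain ⟨w, hw⟩ := exists_control_of_selection hM0.le hf hfg (fun v => hM _ (hgC v)) q
    have hw' := gaugeCost_le_of_ae_maximizer h0 (hw.mono fun t ht =>
      ⟨g (q t), hgC _, hgmax _, ht⟩)
    have hwtop : gaugeCost C μ w ≠ ∞ := ne_top_of_le_ne_top ENNReal.ofReal_ne_top hw'
    have hqw : 0 ≤ inner ℝ q w := by
      rw [L2.inner_def]
      refine integral_nonneg_of_ae ?_
      filter_upwards [hw] with t ht
      rw [ht, inner_smul_right]
      exact mul_self_nonneg _
    have h1 := hF.le_realConj q hwtop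
    have h2 := (ENNReal.le_ofReal_iff_toReal_le hwtop (by positivity)).1 hw'
    rw [toReal_gaugeCost hcl hconv h0 hu] at hle
    have h3 : 1 / 2 * ∫ t, (gaugeFun C (u t)).toReal ^ 2 ∂μ + 1 / 2 * inner ℝ q w ≤
        inner ℝ q u := by linarith
    have hi1 := (integrable_gaugeFun_sq hcl hconv h0 hu).const_mul (1 / 2)
    have hi2 := (L2.integrable_inner (𝕜 := ℝ) q w).const_mul (1 / 2)
    have hi3 := L2.integrable_inner (𝕜 := ℝ) q u
    have hpt : ∀ᵐ t ∂μ, gaugeFun C (u t) ≠ ∞ ∧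
        inner ℝ (q t) (w t) = inner ℝ (q t) (g (q t)) ^ 2 ∧
        inner ℝ (q t) (u t) ≤ (gaugeFun C (u t)).toReal * inner ℝ (q t) (g (q t)) := by
      filter_upwards [hw, ae_gaugeFun_ne_top hcl hconv h0 hu] with t ht htop
      refine ⟨htop, ?_, inner_le_gaugeFun_mul_of_maximizer hconv h0 (hgmax _) htop⟩
      rw [ht, inner_smul_right, sq]
    have hnn : 0 ≤ᵐ[μ] fun t => 1 / 2 * (gaugeFun C (u t)).toReal ^ 2 +
        1 / 2 * inner ℝ (q t) (w t) - inner ℝ (q t) (u t) := by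
      filter_upwards [hpt] with t ⟨_, h5, h6⟩
      rw [h5, Pi.zero_apply]
      nlinarith [sq_nonneg ((gaugeFun C (u t)).toReal - inner ℝ (q t) (g (q t)))]
    have hzero := (integral_eq_zero_iff_of_nonneg_ae hnn ((hi1.add hi2).sub hi3)).1 (by
      refine le_antisymm ?_ (integral_nonneg_of_ae hnn)
      rw [integral_sub (f := fun t => 1 / 2 * (gaugeFun C (u t)).toReal ^ 2 +
        1 / 2 * inner ℝ (q t) (w t)) (hi1.add hi2) hi3, integral_add hi1 hi2, integral_const_mul,
        integral_const_mul, ← L2.inner_def (𝕜 := ℝ), ← L2.inner_def (𝕜 := ℝ)]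
      linarith)
    filter_upwards [hzero, hpt] with t h4 ⟨h5, h6, h7⟩
    rw [h6, Pi.zero_apply] at h4
    set j := (gaugeFun C (u t)).toReal with hj
    set s := inner ℝ (q t) (g (q t)) with hs
    have hjs : j = s := by
      have : (j - s) ^ 2 ≤ 0 := by nlinarith
      exact sub_eq_zero.1 (by simpa using le_antisymm this (sq_nonneg _))
    have hgauge : gaugeFun C (u t) ≤ ENNReal.ofReal s := by
      rw [← hjs, hj, ENNReal.ofReal_toReal h5]
    have hs0 : 0 ≤ s := hjs ▸ ENNReal.toReal_nonneg
    rcases hs0.eq_or_lt with h8 | h8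
    -- A zero gauge forces `u t = 0` because `C` is bounded.
    · refine ⟨g (q t), hgC _, hgmax _, ?_⟩
      rw [← hs, ← h8, zero_smul]
      have := norm_le_mul_of_gaugeFun_le hconv h0 hs0 hgauge hM
      rw [← h8, zero_mul] at this
      simpa using le_antisymm this (norm_nonneg _)
    · have hus : inner ℝ (q t) (s⁻¹ • u t) = s := by
        rw [inner_smul_right, inv_mul_eq_iff_eq_mul₀ h8.ne']
        rw [hjs] at h4
        linarith
      refine ⟨s⁻¹ • u t, inv_smul_mem_of_gaugeFun_le hcl hconv h0 h8 hgauge, ?_, ?_⟩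
      · rw [hus]
        exact hgmax _
      · rw [hus, smul_smul, mul_inv_cancel₀ h8.ne', one_smul]
  · intro h
    have hle := gaugeCost_le_of_ae_maximizer h0 h
    have hu : gaugeCost C μ u ≠ ∞ := ne_top_of_le_ne_top ENNReal.ofReal_ne_top hle
    refine ⟨hu, ?_⟩
    have hqu : 0 ≤ inner ℝ q u := by
      rw [L2.inner_def]
      refine integral_nonneg_of_ae ?_
      filter_upwards [h] with t ⟨c, _, _, hut⟩
      rw [hut, inner_smul_right]
      exact mul_self_nonneg _
    have h1 := (ENNReal.le_ofReal_iff_toReal_le hu (by positivity)).1 hle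
    suffices realConj (gaugeCost C μ) q ≤ 1 / 2 * inner ℝ q u by linarith
    refine hF.realConj_le_iff.2 fun v hv => ?_
    rw [toReal_gaugeCost hcl hconv h0 hv]
    have hi1 := (integrable_gaugeFun_sq hcl hconv h0 hv).const_mul (1 / 2)
    have hi2 := (L2.integrable_inner (𝕜 := ℝ) q u).const_mul (1 / 2)
    have h2 : inner ℝ q v ≤ ∫ t, (1 / 2 * (gaugeFun C (v t)).toReal ^ 2 +
        1 / 2 * inner ℝ (q t) (u t)) ∂μ := by
      rw [L2.inner_def]
      refine integral_mono_ae (L2.integrable_inner (𝕜 := ℝ) q v) (hi1.add hi2) ?_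
      filter_upwards [h, ae_gaugeFun_ne_top hcl hconv h0 hv] with t ⟨c, hc, hmax, hut⟩ htop
      have h3 := inner_le_gaugeFun_mul_of_maximizer hconv h0 hmax htop
      rw [hut, inner_smul_right]
      nlinarith [sq_nonneg ((gaugeFun C (v t)).toReal - inner ℝ (q t) c)]
    rw [integral_add hi1 hi2, integral_const_mul, integral_const_mul,
      ← L2.inner_def (𝕜 := ℝ)] at h2
    linarith

/-- The conjugate cost vanishes only at functions with values in the polar cone. -/
theorem inner_nonpos_of_realConj_gaugeCost_eq_zero (hcl : IsClosed C) (hconv : Convex ℝ C)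
    (h0 : (0 : U) ∈ C) {M : ℝ} (hM0 : 0 < M) (hM : ∀ c ∈ C, ‖c‖ ≤ M) {q u : Lp U 2 μ}
    (hq : realConj (gaugeCost C μ) q = 0) (hu : ∀ᵐ t ∂μ, u t ∈ genCone C) :
    inner ℝ q u ≤ 0 := by
  have hF := isQuadCost_gaugeCost (μ := μ) hcl hconv h0 hM0 hM
  obtain ⟨f, g, hf, hfg, hgC, hgmax, -⟩ := exists_maximizer_selection hcl hconv h0 hM 0
  -- The control `u` may have infinite cost, so it cannot be tested directly. Instead `w` has finite
  -- cost and `⟪q, w⟫` integrates the square of the support function, which must therefore vanish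
  -- almost everywhere.
  obtain ⟨w, hw⟩ := exists_control_of_selection hM0.le hf hfg (fun v => hM _ (hgC v)) q
  have hwtop : gaugeCost C μ w ≠ ∞ := ne_top_of_le_ne_top ENNReal.ofReal_ne_top
    (gaugeCost_le_of_ae_maximizer h0 (hw.mono fun t ht => ⟨g (q t), hgC _, hgmax _, ht⟩))
  have hqw := hF.realConj_eq_zero_iff.1 hq w hwtop
  have hnn : 0 ≤ᵐ[μ] fun t => inner ℝ (q t) (w t) := by
    filter_upwards [hw] with t ht
    rw [ht, inner_smul_right]
    exact mul_self_nonneg _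
  rw [L2.inner_def] at hqw
  have hzero := (integral_eq_zero_iff_of_nonneg_ae hnn (L2.integrable_inner q w)).1
    (le_antisymm hqw (integral_nonneg_of_ae hnn))
  rw [L2.inner_def]
  refine integral_nonpos_of_ae ?_
  filter_upwards [hzero, hw, hu] with t h1 h2 ⟨a, ha, c, hc, huc⟩
  rw [h2, inner_smul_right, Pi.zero_apply] at h1
  have h3 := hgmax (q t) c hc
  rw [mul_self_eq_zero.1 h1] at h3
  rw [huc, inner_smul_right]
  exact mul_nonpos_of_nonneg_of_nonpos ha.le h3

end GaugeCost

/-! ### Singular normals, uniqueness of the subgradient and extreme points. -/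

section Singular

variable {U : Type*} [NormedAddCommGroup U] [InnerProductSpace ℝ U] {C : Set U}

theorem not_mem_polarCone_genCone {v c : U} (hc : c ∈ C) (h : 0 < inner ℝ v c) :
    v ∈ (polarCone (genCone C))ᶜ := fun hv => by
  have := hv c ⟨1, one_pos, c, hc, (one_smul ℝ c).symm⟩
  rw [real_inner_comm] at this
  linarith

theorem maximizer_eq_of_not_mem_singular {v c d : U}
    (hv : v ∉ singularNormals C ∩ (polarCone (genCone C))ᶜ) (hc : c ∈ C) (hd : d ∈ C)
    (hcmax : ∀ z ∈ C, inner ℝ v z ≤ inner ℝ v c) (hdmax : ∀ z ∈ C, inner ℝ v z ≤ inner ℝ v d)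
    (hpos : 0 < inner ℝ v c) : c = d := by
  by_contra hne
  exact hv ⟨⟨c, hc, d, hd, hne, hcmax, hdmax⟩, not_mem_polarCone_genCone hc hpos⟩

/-- The endpoints of a segment through a maximiser are maximisers too, so uniqueness collapses the
segment. -/
theorem maximizer_mem_extremePoints {v c : U}
    (hv : v ∉ singularNormals C ∩ (polarCone (genCone C))ᶜ) (hc : c ∈ C)
    (hcmax : ∀ z ∈ C, inner ℝ v z ≤ inner ℝ v c) (hpos : 0 < inner ℝ v c) :
    c ∈ extremePoints ℝ C := by
  refine ⟨hc, fun x hx y hy ⟨a, b, ha, hb, hab, hxy⟩ => ?_⟩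
  have h1 := hcmax x hx
  have h2 := hcmax y hy
  have h3 : a * inner ℝ v x + b * inner ℝ v y = inner ℝ v c := by
    rw [← hxy, inner_add_right, inner_smul_right, inner_smul_right]
  have h4 : inner ℝ v c ≤ inner ℝ v x := by
    obtain rfl : b = 1 - a := by linarith
    have h5 := mul_le_mul_of_nonneg_left h2 hb.le
    exact le_of_mul_le_mul_left (by linarith) ha
  exact (maximizer_eq_of_not_mem_singular hv hc hx hcmax (fun z hz => (hcmax z hz).trans h4)
    hpos).symm

variable {α : Type*} [MeasurableSpace α] {μ : Measure α} [CompleteSpace U]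

/-- Off the singular normals there is at most one subgradient. -/
theorem subdifferential_gaugeCost_subsingleton (hcl : IsClosed C) (hconv : Convex ℝ C)
    (h0 : (0 : U) ∈ C) {M : ℝ} (hM0 : 0 < M) (hM : ∀ c ∈ C, ‖c‖ ≤ M) {q : Lp U 2 μ}
    (hq : ∀ᵐ t ∂μ, q t ∉ singularNormals C ∩ (polarCone (genCone C))ᶜ) :
    (subdifferential (conjugate fun u => (gaugeCost C μ u : EReal)) q).Subsingleton := by
  intro u hu v hv
  rw [mem_subdifferential_gaugeCost_iff hcl hconv h0 hM0 hM] at hu hv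
  refine Lp.ext ?_
  filter_upwards [hq, hu, hv] with t ht ⟨c, hc, hcmax, huc⟩ ⟨d, hd, hdmax, hvd⟩
  have hcd : inner ℝ (q t) c = inner ℝ (q t) d := le_antisymm (hdmax c hc) (hcmax d hd)
  have hs : 0 ≤ inner ℝ (q t) c := by simpa using hcmax 0 h0
  rcases hs.eq_or_lt with h1 | h1
  · rw [huc, hvd, ← hcd, ← h1, zero_smul, zero_smul]
  · rw [huc, hvd, maximizer_eq_of_not_mem_singular ht hc hd hcmax hdmax h1]

/-- If there is only one subgradient, the singular normals are avoided almost everywhere. -/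
theorem ae_not_mem_singular_of_subsingleton [TopologicalSpace.SeparableSpace U]
    (hcl : IsClosed C) (hconv : Convex ℝ C) (h0 : (0 : U) ∈ C) {M : ℝ} (hM0 : 0 < M)
    (hM : ∀ c ∈ C, ‖c‖ ≤ M) {q : Lp U 2 μ}
    (hq : (subdifferential (conjugate fun u => (gaugeCost C μ u : EReal)) q).Subsingleton) :
    ∀ᵐ t ∂μ, q t ∉ singularNormals C ∩ (polarCone (genCone C))ᶜ := by
  -- One selection per point of a dense sequence, each picking the maximiser nearest to that point.
  -- Countability lets a single null set serve them all.
  choose f g hf hfg hgC hgmax hgnear using fun n : ℕ =>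
    exists_maximizer_selection hcl hconv h0 hM (TopologicalSpace.denseSeq U n)
  choose w hw using fun n =>
    exists_control_of_selection hM0.le (hf n) (hfg n) (fun v => hM _ (hgC n v)) q
  have hwmem : ∀ n, w n ∈ subdifferential (conjugate fun u => (gaugeCost C μ u : EReal)) q :=
    fun n => (mem_subdifferential_gaugeCost_iff hcl hconv h0 hM0 hM).2
      ((hw n).mono fun t ht => ⟨g n (q t), hgC _ _, hgmax _ _, ht⟩)
  filter_upwards [ae_all_iff.2 hw] with t ht
  rintro ⟨⟨x, hx, y, hy, hxy, hxmax, hymax⟩, hpol⟩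
  have hs : 0 < inner ℝ (q t) x := by
    by_contra! hle
    refine hpol ?_
    rintro _ ⟨a, ha, p, hp, rfl⟩
    rw [real_inner_smul_left, real_inner_comm]
    exact mul_nonpos_of_nonneg_of_nonpos ha.le ((hxmax p hp).trans hle)
  have hgs : ∀ n, inner ℝ (q t) (g n (q t)) = inner ℝ (q t) x := fun n =>
    le_antisymm (hxmax _ (hgC _ _)) (hgmax _ _ _ hx)
  have hconst : ∀ n, g n (q t) = g 0 (q t) := by
    intro n
    have h1 := ht n
    rw [hq (hwmem n) (hwmem 0), ht 0, hgs, hgs] at h1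
    exact (smul_right_injective U hs.ne' h1).symm
  -- The common selected point is at least as near as the maximiser `z` to every dense point, hence
  -- to every point, including `z` itself.
  have key : ∀ z ∈ C, inner ℝ (q t) x ≤ inner ℝ (q t) z → g 0 (q t) = z := by
    intro z hz hxz
    have hclosed : IsClosed {p : U | ‖g 0 (q t) - p‖ ≤ ‖z - p‖} :=
      isClosed_le (by fun_prop) (by fun_prop)
    have hall : closure (range (TopologicalSpace.denseSeq U)) ⊆
        {p : U | ‖g 0 (q t) - p‖ ≤ ‖z - p‖} := by
      refine closure_minimal ?_ hclosed
      rintro _ ⟨n, rfl⟩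
      have h1 := hgnear n (q t) z hz ((hgs n).trans_le hxz)
      rwa [hconst n] at h1
    have h2 : ‖g 0 (q t) - z‖ ≤ ‖z - z‖ :=
      hall ((TopologicalSpace.denseRange_denseSeq U).closure_range ▸ mem_univ z)
    simpa [sub_eq_zero] using h2
  exact hxy ((key x hx le_rfl).symm.trans (key y hy (hymax x hx)))

/-- Off the singular normals, the subgradients take values in the cone generated by the extreme
points. -/
theorem ae_mem_genCone_of_extremePoints_subset (hcl : IsClosed C) (hconv : Convex ℝ C)
    (h0 : (0 : U) ∈ C) {M : ℝ} (hM0 : 0 < M) (hM : ∀ c ∈ C, ‖c‖ ≤ M) {K : Set U}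
    (hK0 : (0 : U) ∈ K) (hK : extremePoints ℝ C ⊆ K) {q u : Lp U 2 μ}
    (hq : ∀ᵐ t ∂μ, q t ∉ singularNormals C ∩ (polarCone (genCone C))ᶜ)
    (hu : u ∈ subdifferential (conjugate fun u => (gaugeCost C μ u : EReal)) q) :
    ∀ᵐ t ∂μ, u t ∈ genCone K := by
  filter_upwards [hq, (mem_subdifferential_gaugeCost_iff hcl hconv h0 hM0 hM).1 hu]
    with t ht ⟨c, hc, hcmax, huc⟩
  have hs : 0 ≤ inner ℝ (q t) c := by simpa using hcmax 0 h0
  rcases hs.eq_or_lt with h1 | h1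
  · exact ⟨1, one_pos, 0, hK0, by rw [huc, ← h1, zero_smul, smul_zero]⟩
  · exact ⟨_, h1, c, hK (maximizer_mem_extremePoints ht hc hcmax h1), huc⟩

end Singular

/-! ### Reachability and the dual condition. -/

section Reachability

variable {X U : Type*} [NormedAddCommGroup X] [InnerProductSpace ℝ X] [CompleteSpace X]
  [NormedAddCommGroup U] [InnerProductSpace ℝ U] [CompleteSpace U]

theorem steers_iff (S : C0Semigroup X) (B : U →L[ℝ] X) (T : ℝ) (y₀ yf : X) (ε : ℝ)
    (u : ControlSpace U T) :
    Steers S B T y₀ yf ε u ↔ ‖inputMap S B T u - (yf - S.op T.toNNReal y₀)‖ ≤ ε := by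
  rw [Steers, mildSolution, Metric.mem_closedBall, dist_eq_norm, inputMap_apply]
  congr! 2
  abel

theorem approxReachable_iff (S : C0Semigroup X) (B : U →L[ℝ] X) (T : ℝ) (y₀ yf : X) {C : Set U}
    (hcl : IsClosed C) (hconv : Convex ℝ C) (h0 : (0 : U) ∈ C) {M : ℝ} (hM0 : 0 < M)
    (hM : ∀ c ∈ C, ‖c‖ ≤ M) :
    ApproxReachable S B T (genCone C) y₀ yf ↔
      ∀ p : X, realConj (gaugeCost C (volume.restrict (Ioo (0 : ℝ) T)))
        ((inputMap S B T).adjoint p) = 0 → inner ℝ (yf - S.op T.toNNReal y₀) p ≤ 0 := by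
  have hF := isQuadCost_gaugeCost (μ := volume.restrict (Ioo (0 : ℝ) T)) hcl hconv h0 hM0 hM
  constructor
  · intro h p hp
    refine le_of_forall_pos_le_add fun δ hδ => ?_
    -- With this radius the error term in `⟪y, p⟫` is at most `δ`; the added 1 covers `p = 0`.
    obtain ⟨u, hu, hsteer⟩ := h (δ / (‖p‖ + 1)) (by positivity)
    rw [steers_iff] at hsteer
    set y := yf - S.op T.toNNReal y₀
    have h1 := inner_nonpos_of_realConj_gaugeCost_eq_zero hcl hconv h0 hM0 hM hp hu
    rw [ContinuousLinearMap.adjoint_inner_left, real_inner_comm] at h1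
    have h2 : inner ℝ (y - inputMap S B T u) p ≤ δ / (‖p‖ + 1) * ‖p‖ := by
      refine (real_inner_le_norm _ _).trans ?_
      rw [norm_sub_rev]
      gcongr
    rw [inner_sub_left] at h2
    have h3 : δ / (‖p‖ + 1) * ‖p‖ ≤ δ := by
      rw [div_mul_eq_mul_div, div_le_iff₀ (by positivity)]
      nlinarith [norm_nonneg p]
    linarith
  · intro h ε hε
    obtain ⟨_, ⟨u, hu, rfl⟩, hdist⟩ := Metric.mem_closure_iff.1
      ((hF.mem_closure_image_domain_iff (inputMap S B T) _).2 h) ε hε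
    refine ⟨u, (ae_gaugeFun_ne_top hcl hconv h0 hu).mono fun t ht =>
      mem_genCone_of_gaugeFun_ne_top ht, ?_⟩
    rw [steers_iff, norm_sub_rev, ← dist_eq_norm]
    exact hdist.le

end Reachability

end ConicControl

theorem theorem1 {X U : Type*}
    [NormedAddCommGroup X] [InnerProductSpace ℝ X] [CompleteSpace X]
    [NormedAddCommGroup U] [InnerProductSpace ℝ U] [CompleteSpace U]
    (A : X →ₗ.[ℝ] X) (S : C0Semigroup X) (hA : IsGenerator A S)
    (B : U →L[ℝ] X) (T : ℝ) (hT : 0 < T) (y₀ yf : X)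
    (𝒰 : Set U) (h𝒰 : Bornology.IsBounded 𝒰) (h0 : (0 : U) ∈ 𝒰) :
    -- approximate reachability under the relaxed cone is equivalent to the dual condition
    (ApproxReachable S B T (genCone (relaxedSet 𝒰)) y₀ yf ↔
      ∀ pf : X, dualCost (relaxedSet 𝒰) T ((inputMap S B T).adjoint pf) = 0 →
        inner ℝ (yf - S.op T.toNNReal y₀) pf ≤ 0) ∧
    -- under this condition, for every `ε > 0`:
    ((∀ pf : X, dualCost (relaxedSet 𝒰) T ((inputMap S B T).adjoint pf) = 0 →
        inner ℝ (yf - S.op T.toNNReal y₀) pf ≤ 0) →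
      ∀ ε : ℝ, 0 < ε →
        -- the dual functional has a unique minimiser
        (∃! pf : X, IsMinOn (dualFunctional S B T (relaxedSet 𝒰) y₀ yf ε) univ pf) ∧
        ∀ pf : X, IsMinOn (dualFunctional S B T (relaxedSet 𝒰) y₀ yf ε) univ pf →
          -- some control in the subdifferential steers `y₀` to the closed ball
          (∃ u ∈ subdifferential (dualCost (relaxedSet 𝒰) T) ((inputMap S B T).adjoint pf),
            Steers S B T y₀ yf ε u) ∧
          -- (H) implies that the subdifferential is a singleton
          (AvoidsSingular (relaxedSet 𝒰) ((inputMap S B T).adjoint pf) →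
            ∃! u, u ∈ subdifferential (dualCost (relaxedSet 𝒰) T)
              ((inputMap S B T).adjoint pf)) ∧
          -- the converse
          (TopologicalSpace.SeparableSpace U →
            (∃! u, u ∈ subdifferential (dualCost (relaxedSet 𝒰) T)
              ((inputMap S B T).adjoint pf)) →
            AvoidsSingular (relaxedSet 𝒰) ((inputMap S B T).adjoint pf)) ∧
          -- under (H) and (E), the unique control takes its values in the original cone
          (AvoidsSingular (relaxedSet 𝒰) ((inputMap S B T).adjoint pf) →
            Set.extremePoints ℝ (relaxedSet 𝒰) ⊆ 𝒰 →
            ∀ u ∈ subdifferential (dualCost (relaxedSet 𝒰) T) ((inputMap S B T).adjoint pf),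
              Steers S B T y₀ yf ε u ∧ TakesValuesIn u (genCone 𝒰))) := by
  have hcl : IsClosed (relaxedSet 𝒰) := isClosed_closure
  have hconv : Convex ℝ (relaxedSet 𝒰) := (convex_convexHull ℝ 𝒰).closure
  have hsub : 𝒰 ⊆ relaxedSet 𝒰 := (subset_convexHull ℝ 𝒰).trans subset_closure
  obtain ⟨M, hM0, hM⟩ : ∃ M : ℝ, 0 < M ∧ ∀ c ∈ relaxedSet 𝒰, ‖c‖ ≤ M := by
    obtain ⟨M, hM0, hM⟩ := ((isBounded_convexHull.2 h𝒰).closure).exists_pos_norm_le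
    exact ⟨M, hM0, hM⟩
  have hF := isQuadCost_gaugeCost (μ := volume.restrict (Ioo (0 : ℝ) T)) hcl hconv (hsub h0)
    hM0 hM
  have hdual : ∀ q, dualCost (relaxedSet 𝒰) T q =
      (realConj (gaugeCost (relaxedSet 𝒰) (volume.restrict (Ioo (0 : ℝ) T))) q : EReal) :=
    -- `primalCost` is `gaugeCost` for the restricted Lebesgue measure by definition.
    hF.conjugate_eq
  have hcond : ∀ pf : X, (dualCost (relaxedSet 𝒰) T ((inputMap S B T).adjoint pf) = 0 ↔
      realConj (gaugeCost (relaxedSet 𝒰) (volume.restrict (Ioo (0 : ℝ) T)))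
        ((inputMap S B T).adjoint pf) = 0) := fun pf => by
    rw [hdual, EReal.coe_eq_zero]
  have hmin : ∀ (ε : ℝ) (p : X),
      IsMinOn (dualFunctional S B T (relaxedSet 𝒰) y₀ yf ε) univ p ↔ ∀ p' : X,
      realConj (gaugeCost (relaxedSet 𝒰) (volume.restrict (Ioo (0 : ℝ) T)))
        ((inputMap S B T).adjoint p) - inner ℝ (yf - S.op T.toNNReal y₀) p + ε * ‖p‖ ≤
      realConj (gaugeCost (relaxedSet 𝒰) (volume.restrict (Ioo (0 : ℝ) T)))
        ((inputMap S B T).adjoint p') - inner ℝ (yf - S.op T.toNNReal y₀) p' + ε * ‖p'‖ := by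
    intro ε p
    rw [isMinOn_univ_iff]
    refine forall_congr' fun p' => ?_
    simp only [dualFunctional, hdual]
    norm_cast
  simp only [hcond]
  refine ⟨approxReachable_iff S B T y₀ yf hcl hconv (hsub h0) hM0 hM, fun h ε hε => ⟨?_, ?_⟩⟩
  · obtain ⟨p, hp⟩ := hF.exists_min_dual (inputMap S B T) _ hε
      ((hF.mem_closure_image_domain_iff (inputMap S B T) _).2 h)
    exact ⟨p, (hmin ε p).2 hp, fun p' hp' =>
      hF.min_dual_unique (inputMap S B T) _ hε h ((hmin ε p').1 hp') hp⟩
  intro p hp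
  obtain ⟨u, hu, huy⟩ := hF.exists_subgradient_of_min_dual (inputMap S B T) _ hε.le
    ((hmin ε p).1 hp)
  have hu' : u ∈ subdifferential (dualCost (relaxedSet 𝒰) T) ((inputMap S B T).adjoint p) := hu
  have hsteer := (steers_iff S B T y₀ yf ε u).2 huy
  refine ⟨⟨u, hu', hsteer⟩, fun hH => ⟨u, hu', fun v hv => ?_⟩, fun hsep huniq => ?_,
    fun hH hE v hv => ?_⟩
  · exact subdifferential_gaugeCost_subsingleton hcl hconv (hsub h0) hM0 hM hH hv hu
  · exact ae_not_mem_singular_of_subsingleton hcl hconv (hsub h0) hM0 hM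
      fun v hv w hw => huniq.unique hv hw
  -- By uniqueness `v` is the steering subgradient already found, so it inherits the steering
  -- property.
  · obtain rfl : v = u :=
      subdifferential_gaugeCost_subsingleton hcl hconv (hsub h0) hM0 hM hH hv hu
    exact ⟨hsteer,
      ae_mem_genCone_of_extremePoints_subset hcl hconv (hsub h0) hM0 hM h0 hE hH hu⟩
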